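/- For $k,n\in\mathbb{N}$, a function $f\colon\{0,1\}^n\to\{0,1\}$ is a $k$-junta if it depends on at most $k$ of its $n$ variables, and it is $\epsilon$-far from every $k$-junta if it disagrees with each $k$-junta on at least $\epsilon 2^n$ inputs. A non-adaptive algorithm with $q$ queries is a randomized algorithm that chooses $q$ query strings in $\{0,1\}^n$ before it sees any value of the unknown function $f$, and then, from the $q$ values of $f$ on these strings and its internal randomness, accepts or rejects. It is an $\epsilon$-tester for $k$-juntas if it accepts with probability at least $5/6$ whenever $f$ is a $k$-junta, and rejects with probability at least $5/6$ whenever $f$ is $\epsilon$-far from every $k$-junta. Theorem. Let $\alpha\in(0.5,1)$ be a constant. If $k=\alpha n$ (rounded up or down to an integer) and $2^{-(2\alpha-1)n/2}\le\epsilon\le 1/6$, then every non-adaptive $\epsilon$-tester for $k$-juntas must make $\widetilde{\Omega}(n^{3/2}/\epsilon)$ queries. That is, there are constants $c>0$, $C\in\mathbb{N}$ and $n_0\in\mathbb{N}$, depending only on $\alpha$, such that for all $n\ge n_0$, all $k\in\mathbb{N}$ with $|k-\alpha n|<1$ and all real $\epsilon$ with $2^{-(2\alpha-1)n/2}\le\epsilon\le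 1/6$, the number $q$ of queries of every non-adaptive $\epsilon$-tester for $k$-juntas of functions $f\colon\{0,1\}^n\to\{0,1\}$ satisfies $$q\ \ge\ c\cdot\frac{n^{3/2}/\epsilon}{\bigl(\log (n^{3/2}/\epsilon)\bigr)^{C}}.$$ -/

import Mathlib

namespace JuntaTesting

/-- A Boolean function on the hypercube `{0,1}^n`. -/
abbrev BoolFun (n : ℕ) : Type := (Fin n → Bool) → Bool

/-- `f` is a `k`-junta: it is a function of the coordinates in some set `S` of at most `k`
variables. -/
def IsJunta {n : ℕ} (k : ℕ) (f : BoolFun n) : Prop :=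
  ∃ S : Finset (Fin n), S.card ≤ k ∧
    ∃ g : (S → Bool) → Bool, ∀ x : Fin n → Bool, f x = g (fun i => x i)

/-- `f` is `ε`-far from every `k`-junta: it disagrees with each of them on at least `ε * 2 ^ n`
inputs (`hammingDist f g` is the number of inputs `x` with `f x ≠ g x`). -/
def IsFarFromJuntas {n : ℕ} (k : ℕ) (ε : ℝ) (f : BoolFun n) : Prop :=
  ∀ g : BoolFun n, IsJunta k g → ε * (2 : ℝ) ^ n ≤ (hammingDist f g : ℝ)

/-- A deterministic non-adaptive algorithm with `q` queries to a function on `{0,1}^n`: a list of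
`q` query strings, fixed in advance, and a map from the `q` answers to a verdict
(`true` is "accept", `false` is "reject"). -/
structure DetAlg (n q : ℕ) where
  /-- the query strings -/
  query : Fin q → (Fin n → Bool)
  /-- the verdict, given the answers -/
  verdict : (Fin q → Bool) → Bool

/-- The output of a deterministic algorithm with black-box access to `f`. -/
def DetAlg.run {n q : ℕ} (D : DetAlg n q) (f : BoolFun n) : Bool :=
  D.verdict (fun j => f (D.query j))

/-- A (randomized) non-adaptive algorithm with `q` queries: its internal randomness selects, before
any answer is seen, the query strings together with the rule that turns the answers into a
verdict. -/
abbrev NonAdaptiveAlg (n q : ℕ) : Type := PMF (DetAlg n q)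

/-- The distribution of the output of a randomized non-adaptive algorithm on `f`. -/
noncomputable def NonAdaptiveAlg.output {n q : ℕ} (A : NonAdaptiveAlg n q) (f : BoolFun n) :
    PMF Bool :=
  PMF.map (fun D : DetAlg n q => D.run f) A

/-- `A` is an `ε`-tester for `k`-juntas: it accepts every `k`-junta with probability at least `5/6`
and rejects every function that is `ε`-far from all `k`-juntas with probability at least `5/6`. -/
def IsJuntaTester {n q : ℕ} (k : ℕ) (ε : ℝ) (A : NonAdaptiveAlg n q) : Prop :=
  (∀ f : BoolFun n, IsJunta k f → 5 / 6 ≤ NonAdaptiveAlg.output A f true) ∧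
  (∀ f : BoolFun n, IsFarFromJuntas k ε f → 5 / 6 ≤ NonAdaptiveAlg.output A f false)

end JuntaTesting

/-! Two random functions are built that few queries cannot tell apart, although one is almost surely
a `k`-junta and the other almost surely `ε`-far from all of them. A random set `M` of density `2α -
1` cuts the cube into subcubes, one for each assignment (address) to `M`. On each subcube the
function is a random constant. With probability `6ε` the subcube also carries the parity of the
variables in `S ∩ A`, where `S` is a fresh random set of density `1/√n` for each subcube and `A` is
one global random set. The only difference between the two functions is the density of `A`, which is
`1/2 - δ` or `1/2 + δ` with `δ` of order `1/√n`.

Only variables in `M ∪ A` matter, and the expected size of this union is `αn - 9√n` or `αn + 9√n`,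
against fluctuations of order `√n`. The lower density thus gives a junta (`exFun_not_junta_le`).
With the higher density, a `k`-junta either omits a variable of `M`, each of which has large
influence by a second moment bound (`ex_ind_flip_le`), or keeps `M` and omits at least `3√n`
variables of `A`. In the second case most of the parity sets meet the omitted variables
(`ex_ind_parity_le`), and the junta errs on half of those subcubes (`isFarFromJuntas_addrFun`,
`exFun_not_far_le`).

The random constants hide everything except differences between queries with a common address, so a
variable of `A` can be seen at an address only if the queries there differ in it. Queries at
distance at least `L` share an address with probability at most `(2(1 - α))^L`; hence, for `L` of
order `log (n^(3/2)/ε)`, `q` queries expose about `qL` pairs of an address and a variable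
(`ex_sum_spread_le`). Such a pair is active only with probability `6ε/√n`, and a chi-square bound
charges `O(δ²) = O(1/n)` for each active pair (`abs_ex_mix_sub_le`). A constant advantage therefore
forces `εqL/n^(3/2)` to be bounded below. -/

namespace JuntaTesting

open Finset

/-! ### Finite expectations and product laws -/

/-- The sum of `F` with weights `w`; the expectation of `F` when `w` is a probability weight. -/
def ex {Ω : Type*} [Fintype Ω] (w F : Ω → ℝ) : ℝ := ∑ x, w x * F x

/-- `w` is a probability weight. -/
def IsProb {Ω : Type*} [Fintype Ω] (w : Ω → ℝ) : Prop := (∀ x, 0 ≤ w x) ∧ ∑ x, w x = 1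

/-- The product weight. -/
def piW {ι Ω : Type*} [Fintype ι] (w : ι → Ω → ℝ) (x : ι → Ω) : ℝ := ∏ i, w i (x i)

/-- The Bernoulli weight. -/
def bern (p : ℝ) (b : Bool) : ℝ := if b then p else 1 - p

/-- The weight of a vector of independent Bernoulli variables. -/
def bv {ι : Type*} [Fintype ι] (p : ℝ) : (ι → Bool) → ℝ := piW fun _ => bern p

/-- The indicator of a proposition. -/
noncomputable def ind (P : Prop) : ℝ := by
  classical exact if P then 1 else 0

theorem ind_true {P : Prop} (h : P) : ind P = 1 := by simp [ind, h]

theorem ind_false {P : Prop} (h : ¬ P) : ind P = 0 := by simp [ind, h]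

theorem ind_nonneg (P : Prop) : 0 ≤ ind P := by unfold ind; split_ifs <;> norm_num

theorem ind_mono {P Q : Prop} (h : P → Q) : ind P ≤ ind Q := by
  by_cases hP : P
  · rw [ind_true hP, ind_true (h hP)]
  · rw [ind_false hP]; exact ind_nonneg _

theorem ind_le_of {P : Prop} {a : ℝ} (h0 : 0 ≤ a) (h : P → 1 ≤ a) : ind P ≤ a := by
  by_cases hP : P
  · rw [ind_true hP]; exact h hP
  · rw [ind_false hP]; exact h0

section
variable {Ω Ω' : Type*} [Fintype Ω] [Fintype Ω'] {w : Ω → ℝ} {w' : Ω' → ℝ} {F G : Ω → ℝ}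

theorem ex_add : ex w (fun x => F x + G x) = ex w F + ex w G := by
  simp [ex, mul_add, sum_add_distrib]

theorem ex_sub : ex w (fun x => F x - G x) = ex w F - ex w G := by
  simp [ex, mul_sub, sum_sub_distrib]

theorem ex_mul_left (a : ℝ) : ex w (fun x => a * F x) = a * ex w F := by
  simp [ex, mul_sum, mul_left_comm]

theorem ex_sum {κ : Type*} (s : Finset κ) (F : κ → Ω → ℝ) :
    ex w (fun x => ∑ j ∈ s, F j x) = ∑ j ∈ s, ex w (F j) := by
  simp only [ex, mul_sum]; rw [sum_comm]

theorem ex_comm (F : Ω → Ω' → ℝ) :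
    ex w (fun x => ex w' (fun y => F x y)) = ex w' (fun y => ex w (fun x => F x y)) := by
  simp only [ex, mul_sum]; rw [sum_comm]
  exact sum_congr rfl fun _ _ => sum_congr rfl fun _ _ => by ring

theorem IsProb.ex_const (hw : IsProb w) (a : ℝ) : ex w (fun _ => a) = a := by
  simp [ex, ← sum_mul, hw.2]

theorem IsProb.ex_mono (hw : IsProb w) (h : ∀ x, F x ≤ G x) : ex w F ≤ ex w G :=
  sum_le_sum fun x _ => mul_le_mul_of_nonneg_left (h x) (hw.1 x)

theorem IsProb.ex_le (hw : IsProb w) {a : ℝ} (h : ∀ x, F x ≤ a) : ex w F ≤ a :=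
  (hw.ex_mono h).trans_eq (hw.ex_const a)

theorem IsProb.le_ex (hw : IsProb w) {a : ℝ} (h : ∀ x, a ≤ F x) : a ≤ ex w F :=
  (hw.ex_const a).symm.trans_le (hw.ex_mono h)

theorem IsProb.ex_nonneg (hw : IsProb w) (h : ∀ x, 0 ≤ F x) : 0 ≤ ex w F := hw.le_ex h

theorem IsProb.abs_ex_le (hw : IsProb w) : |ex w F| ≤ ex w (fun x => |F x|) := by
  unfold ex
  refine (abs_sum_le_sum_abs _ _).trans_eq (sum_congr rfl fun x _ => ?_)
  rw [abs_mul, abs_of_nonneg (hw.1 x)]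

/-- Cauchy–Schwarz. -/
theorem IsProb.sq_ex_le (hw : IsProb w) : ex w F ^ 2 ≤ ex w (fun x => F x ^ 2) := by
  have h := hw.ex_nonneg (F := fun x => (F x - ex w F) ^ 2) fun x => sq_nonneg _
  have h2 : ex w (fun x => (F x - ex w F) ^ 2) = ex w (fun x => F x ^ 2) - ex w F ^ 2 := by
    have : (fun x => (F x - ex w F) ^ 2) =
        fun x => (F x ^ 2 - 2 * ex w F * F x) + ex w F ^ 2 := by
      funext x; ring
    rw [this, ex_add, ex_sub, ex_mul_left, hw.ex_const]; ring
  linarith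

end

theorem ex_piW_prod {ι Ω : Type*} [Fintype ι] [DecidableEq ι] [Fintype Ω] (w F : ι → Ω → ℝ) :
    ex (piW w) (fun x => ∏ i, F i (x i)) = ∏ i, ex (w i) (F i) := by
  simp only [ex, piW, ← prod_mul_distrib]
  rw [Finset.prod_univ_sum]
  simp

theorem IsProb.piW {ι Ω : Type*} [Fintype ι] [DecidableEq ι] [Fintype Ω] {w : ι → Ω → ℝ}
    (h : ∀ i, IsProb (w i)) : IsProb (piW w) := by
  refine ⟨fun x => prod_nonneg fun i _ => (h i).1 _, ?_⟩
  have := ex_piW_prod w (fun _ _ => 1)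
  simpa [ex, fun i => (h i).2] using this

theorem ex_bern (p : ℝ) (F : Bool → ℝ) : ex (bern p) F = p * F true + (1 - p) * F false := by
  simp [ex, bern]

theorem isProb_bern {p : ℝ} (h0 : 0 ≤ p) (h1 : p ≤ 1) : IsProb (bern p) := by
  refine ⟨fun b => by cases b <;> simp [bern, h0, h1], by simp [bern]⟩

theorem isProb_bv {ι : Type*} [Fintype ι] [DecidableEq ι] {p : ℝ} (h0 : 0 ≤ p) (h1 : p ≤ 1) :
    IsProb (bv (ι := ι) p) := .piW fun _ => isProb_bern h0 h1

theorem ex_bv_prod {ι : Type*} [Fintype ι] [DecidableEq ι] (p : ℝ) (F : ι → Bool → ℝ) :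
    ex (bv p) (fun x => ∏ i, F i (x i)) = ∏ i, (p * F i true + (1 - p) * F i false) := by
  rw [bv, ex_piW_prod]; simp [ex_bern]

/-- The marginal of one coordinate. -/
theorem ex_bv_apply {ι : Type*} [Fintype ι] [DecidableEq ι] (p : ℝ) (j : ι) (F : Bool → ℝ) :
    ex (bv p) (fun x => F (x j)) = p * F true + (1 - p) * F false := by
  have := ex_bv_prod p (fun (i : ι) b => if i = j then F b else 1)
  simp only [prod_ite_eq', mem_univ, if_true] at this
  rw [this, Finset.prod_eq_single j] <;> simp +contextual

/-- Markov's inequality in exponential form. -/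
theorem IsProb.ex_ind_le_exp {Ω : Type*} [Fintype Ω] {w : Ω → ℝ} (hw : IsProb w) (P : Ω → Prop)
    (Y : Ω → ℝ) (h : ∀ x, P x → 0 ≤ Y x) :
    ex w (fun x => ind (P x)) ≤ ex w (fun x => Real.exp (Y x)) :=
  hw.ex_mono fun x => ind_le_of (Real.exp_pos _).le fun hx => Real.one_le_exp (h x hx)

/-- The law of the coordinatewise image of a product weight is a product weight. -/
theorem ex_piW_map {ι Ω V : Type*} [Fintype ι] [DecidableEq ι] [Fintype Ω] [Fintype V]
    [DecidableEq V] (w : ι → Ω → ℝ) (g : ι → Ω → V) (Φ : (ι → V) → ℝ) :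
    ex (piW w) (fun x => Φ fun i => g i (x i)) =
      ex (piW fun i v => ex (w i) (fun a => if g i a = v then 1 else 0)) Φ := by
  have h : ∀ v : ι → V, piW (fun i v => ex (w i) (fun a => if g i a = v then 1 else 0)) v =
      ex (piW w) (fun x => if (fun i => g i (x i)) = v then 1 else 0) := by
    intro v
    have := ex_piW_prod w (fun i a => if g i a = v i then (1 : ℝ) else 0)
    unfold piW at this ⊢
    rw [← this]
    congr 1; funext x
    rw [Finset.prod_ite_zero]
    simp [funext_iff]
  unfold ex at h ⊢
  simp only [h, sum_mul]
  rw [sum_comm]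
  refine sum_congr rfl fun x _ => ?_
  rw [Finset.sum_eq_single (fun i => g i (x i))] <;> simp +contextual
  intro b hb h'; exact absurd h'.symm hb

theorem exp_le_one_add_add_sq {x : ℝ} (h : |x| ≤ 1) : Real.exp x ≤ 1 + x + x ^ 2 := by
  have := Real.abs_exp_sub_one_sub_id_le h
  have := abs_le.1 this
  linarith [this.2]

/-! ### Chi-square comparison of product mixtures -/

/-- The mixture of `π` (with weight `p`) and the point mass at `o`. -/
def mix {V : Type*} [DecidableEq V] (o : V) (π : V → ℝ) (p : ℝ) (v : V) : ℝ :=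
  p * π v + (1 - p) * if v = o then 1 else 0

theorem isProb_mix {V : Type*} [Fintype V] [DecidableEq V] {o : V} {π : V → ℝ} (hπ : IsProb π)
    {p : ℝ} (h0 : 0 ≤ p) (h1 : p ≤ 1) : IsProb (mix o π p) := by
  constructor
  · intro v
    have := hπ.1 v
    unfold mix
    have : (0 : ℝ) ≤ if v = o then 1 else 0 := by split_ifs <;> norm_num
    have : 0 ≤ 1 - p := by linarith
    positivity
  · simp [mix, sum_add_distrib, ← mul_sum, hπ.2]

/-- The chi-square computation for one coordinate. -/
theorem chiSq_mix_le {s p q : ℝ} (hs0 : 0 ≤ s) (hs1 : s ≤ 1) (hp : 1 / 4 ≤ p) (hp2 : p ≤ 1 / 2) :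
    (q / p) ^ 2 + (((1 - q * s) / (1 - p * s)) ^ 2 - (q / p) ^ 2) * (1 - p * s) ≤
      1 + 8 * (q - p) ^ 2 * s := by
  have hp0 : 0 < p := by linarith
  have h1 : 1 / 2 ≤ 1 - p * s := by nlinarith
  have h1' : 0 < 1 - p * s := by linarith
  -- The left side is the second moment of the likelihood ratio: the point `o` has mass `1 - p * s`,
  -- and the ratio is constantly `q / p` elsewhere.
  have e : (q / p) ^ 2 + (((1 - q * s) / (1 - p * s)) ^ 2 - (q / p) ^ 2) * (1 - p * s) =
      1 + (q - p) ^ 2 * s / (p * (1 - p * s)) := by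
    field_simp
    ring
  rw [e]
  have h2 : 1 / 8 ≤ p * (1 - p * s) := by nlinarith
  have h3 : (q - p) ^ 2 * s / (p * (1 - p * s)) ≤ 8 * (q - p) ^ 2 * s := by
    rw [div_le_iff₀ (by positivity)]
    have : 0 ≤ (q - p) ^ 2 * s := by positivity
    nlinarith
  linarith

/-- Two products of mixtures with nearby mixing parameters are hard to distinguish when the
non-trivial components put little mass outside `o`. -/
theorem abs_ex_mix_sub_le {ι V : Type*} [Fintype ι] [DecidableEq ι] [Fintype V] [DecidableEq V]
    {π : ι → V → ℝ} (hπ : ∀ i, IsProb (π i)) (o : V) {p q η : ℝ} (hp : 1 / 4 ≤ p)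
    (hp2 : p ≤ 1 / 2) (hq : p ≤ q) (hq1 : q ≤ 1) (hη : 0 < η) {Φ : (ι → V) → ℝ}
    (hΦ : ∀ v, 0 ≤ Φ v) (hΦ1 : ∀ v, Φ v ≤ 1) :
    |ex (piW fun i => mix o (π i) q) Φ - ex (piW fun i => mix o (π i) p) Φ| ≤
      η / 2 + 8 * (q - p) ^ 2 * (∑ i, (1 - π i o)) / η := by
  have hp0 : 0 < p := by linarith
  set s : ι → ℝ := fun i => 1 - π i o with hs
  have hs0 : ∀ i, 0 ≤ s i := fun i => by
    have := single_le_sum (fun v _ => (hπ i).1 v) (mem_univ o)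
    rw [(hπ i).2] at this
    simp only [hs]; linarith
  have hs1 : ∀ i, s i ≤ 1 := fun i => by
    have := (hπ i).1 o
    simp only [hs]; linarith
  have hps : ∀ i, 0 < 1 - p * s i := fun i => by nlinarith [hs0 i, hs1 i]
  -- The likelihood ratio of one coordinate. Away from `o` it does not depend on `π i`.
  let l : ι → V → ℝ := fun i v => if v = o then (1 - q * s i) / (1 - p * s i) else q / p
  let L : (ι → V) → ℝ := fun v => ∏ i, l i (v i)
  have hmul : ∀ i v, mix o (π i) q v = mix o (π i) p v * l i v := by
    intro i v
    by_cases hv : v = o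
    · have h0 : p * π i o + (1 - p) * 1 = 1 - p * s i := by simp only [hs]; ring
      have h1 : q * π i o + (1 - q) * 1 = 1 - q * s i := by simp only [hs]; ring
      simp only [mix, l, hv, if_true]
      rw [h0, h1, mul_div_cancel₀ _ (hps i).ne']
    · simp only [mix, l, hv, if_false]
      field_simp
      ring
  set P : (ι → V) → ℝ := piW fun i => mix o (π i) p with hP
  have hPp : IsProb P := .piW fun i => isProb_mix (hπ i) hp0.le (by linarith)
  have hQp : IsProb (piW fun i => mix o (π i) q) :=
    .piW fun i => isProb_mix (hπ i) (by linarith) hq1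
  have hQ : ∀ v, piW (fun i => mix o (π i) q) v = P v * L v := by
    intro v
    simp only [piW, hP, L, hmul, prod_mul_distrib]
  have hL1 : ex P L = 1 := by
    have := hQp.2
    simpa only [ex, hQ] using this
  set x : ℝ := 8 * (q - p) ^ 2 * ∑ i, s i with hx
  have hx0 : 0 ≤ x := by
    have := sum_nonneg fun i (_ : i ∈ univ) => hs0 i
    positivity
  have hL2 : ex P (fun v => L v ^ 2) ≤ Real.exp x := by
    have e := ex_piW_prod (fun i => mix o (π i) p) (fun i v => l i v ^ 2)
    simp only [prod_pow] at e
    rw [hP, e, hx, mul_sum, Real.exp_sum]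
    refine prod_le_prod (fun i _ => (isProb_mix (hπ i) hp0.le (by linarith)).ex_nonneg
      fun v => sq_nonneg _) fun i _ => ?_
    have e2 : (fun v => l i v ^ 2) = fun v => (q / p) ^ 2 +
        (((1 - q * s i) / (1 - p * s i)) ^ 2 - (q / p) ^ 2) * if v = o then 1 else 0 := by
      funext v
      by_cases hv : v = o <;> simp [l, hv]
    have e3 : ex (mix o (π i) p) (fun v => if v = o then 1 else 0) = 1 - p * s i := by
      simp [ex, mix, hs]; ring
    rw [e2, ex_add, ex_mul_left, (isProb_mix (hπ i) hp0.le (by linarith)).ex_const, e3]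
    refine (chiSq_mix_le (hs0 i) (hs1 i) hp hp2).trans ?_
    have := Real.add_one_le_exp (8 * (q - p) ^ 2 * s i)
    linarith
  have hd : ex (piW fun i => mix o (π i) q) Φ - ex P Φ = ex P (fun v => (L v - 1) * Φ v) := by
    have : (fun v => (L v - 1) * Φ v) = fun v => L v * Φ v - Φ v := by funext v; ring
    rw [this, ex_sub]
    congr 1
    simp only [ex, hQ, mul_assoc]
  set d := ex (piW fun i => mix o (π i) q) Φ - ex P Φ with hdd
  have hd2 : d ^ 2 ≤ Real.exp x - 1 := by
    rw [hd]
    refine hPp.sq_ex_le.trans ?_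
    have h1 : ex P (fun v => ((L v - 1) * Φ v) ^ 2) ≤ ex P (fun v => (L v ^ 2 - 2 * L v) + 1) := by
      refine hPp.ex_mono fun v => ?_
      have : Φ v ^ 2 ≤ 1 := by nlinarith [hΦ v, hΦ1 v]
      nlinarith [sq_nonneg (L v - 1)]
    rw [ex_add, ex_sub, ex_mul_left, hL1, hPp.ex_const] at h1
    linarith
  have hd1 : |d| ≤ 1 := by
    have a1 := hQp.ex_nonneg hΦ
    have a2 := hQp.ex_le hΦ1
    have a3 := hPp.ex_nonneg hΦ
    have a4 := hPp.ex_le hΦ1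
    rw [abs_le]; constructor <;> linarith
  -- For `x ≤ 1`, `exp x - 1 ≤ x + x ^ 2 ≤ 2 * x`; for larger `x` the trivial bound `|d| ≤ 1`
  -- suffices.
  have key : d ^ 2 ≤ 2 * x := by
    by_cases h : x ≤ 1
    · have := exp_le_one_add_add_sq (x := x) (by rw [abs_of_nonneg hx0]; exact h)
      nlinarith
    · have : d ^ 2 ≤ 1 := by rw [← sq_abs]; nlinarith [abs_nonneg d]
      linarith
  -- The inequality of arithmetic and geometric means with parameter `η` replaces `√(2x)` by a bound
  -- linear in `x`, which can later be averaged over `M` and `c`.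
  have h3 : η / 2 + x / η = (η ^ 2 + 2 * x) / (2 * η) := by field_simp
  rw [h3, le_div_iff₀ (by positivity)]
  have : |d| ^ 2 ≤ 2 * x := by rwa [sq_abs]
  nlinarith [sq_nonneg (|d| - η)]

/-- The two laws of the masked sets `A i ∧ U i z ∧ S z i` for densities `p` and `q` of `A`. -/
theorem abs_ex_masked_sub_le {ι Z : Type*} [Fintype ι] [DecidableEq ι] [Fintype Z] [DecidableEq Z]
    (U : Z → ι → Bool) {p q η σ : ℝ} (hσ0 : 0 ≤ σ) (hσ1 : σ ≤ 1) (hp : 1 / 4 ≤ p)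
    (hp2 : p ≤ 1 / 2) (hq : p ≤ q) (hq1 : q ≤ 1) (hη : 0 < η) {Φ : (ι → Z → Bool) → ℝ}
    (hΦ : ∀ v, 0 ≤ Φ v) (hΦ1 : ∀ v, Φ v ≤ 1) :
    |ex (bv q) (fun A => ex (piW fun _ => bv σ) fun S => Φ fun i z => A i && (U z i && S z i)) -
      ex (bv p) (fun A => ex (piW fun _ => bv σ) fun S => Φ fun i z => A i && (U z i && S z i))| ≤
      η / 2 + 8 * (q - p) ^ 2 * (σ * ∑ z, ∑ i, if U z i then 1 else 0) / η := by
  let π : ι → (Z → Bool) → ℝ := fun i v =>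
    ex (bv σ) (fun t => if (fun z => U z i && t z) = v then 1 else 0)
  let o : Z → Bool := fun _ => false
  have hbσ : IsProb (bv (ι := Z) σ) := isProb_bv hσ0 hσ1
  have hπ : ∀ i, IsProb (π i) := by
    intro i
    refine ⟨fun v => hbσ.ex_nonneg fun t => by split_ifs <;> norm_num, ?_⟩
    simp only [π]
    rw [← ex_sum univ (fun v (t : Z → Bool) => if (fun z => U z i && t z) = v then (1 : ℝ) else 0)]
    simp [hbσ.ex_const]
  have hrep : ∀ r : ℝ, ex (bv r) (fun A => ex (piW fun _ => bv σ) fun S =>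
      Φ fun i z => A i && (U z i && S z i)) = ex (piW fun i => mix o (π i) r) Φ := by
    intro r
    have h1 : ∀ A : ι → Bool, ex (piW fun _ => bv σ) (fun S : Z → ι → Bool =>
        Φ fun i z => A i && (U z i && S z i)) = ex (piW fun i v =>
          ex (bv σ) (fun t => if (fun z => A i && (U z i && t z)) = v then 1 else 0)) Φ := by
      intro A
      rw [← ex_piW_map (fun _ : ι => bv (ι := Z) σ) (fun i t z => A i && (U z i && t z)) Φ]
      unfold ex
      -- The entries of `S` are all independent, so they may be grouped by variable instead of by
      -- address. The rows indexed by `i` are then independent mixtures.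
      refine Fintype.sum_equiv (Equiv.piComm _) _ _ fun S => ?_
      congr 1
      simp only [piW, bv, Equiv.piComm_apply]
      rw [prod_comm]
    simp only [h1]
    have h2 : ∀ v : ι → Z → Bool, piW (fun i => mix o (π i) r) v = ex (bv r) fun A => piW (fun i v =>
          ex (bv σ) (fun t => if (fun z => A i && (U z i && t z)) = v then 1 else 0)) v := by
      intro v
      have := ex_bv_prod r (fun i a => ex (bv σ)
        (fun t => if (fun z => a && (U z i && t z)) = v i then (1 : ℝ) else 0))
      unfold piW at this ⊢
      rw [this]
      refine prod_congr rfl fun i _ => ?_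
      simp only [mix, π, Bool.true_and, Bool.false_and, hbσ.ex_const, o, eq_comm (a := v i)]
    unfold ex at h2 ⊢
    simp only [h2, sum_mul, mul_sum]
    rw [sum_comm]
    exact sum_congr rfl fun _ _ => sum_congr rfl fun _ _ => by ring
  rw [hrep, hrep]
  refine (abs_ex_mix_sub_le hπ o hp hp2 hq hq1 hη hΦ hΦ1).trans ?_
  -- A union bound over `z`: a row is nonzero only if some unmasked entry of it is.
  have hs : ∑ i, (1 - π i o) ≤ σ * ∑ z, ∑ i, if U z i then 1 else 0 := by
    rw [sum_comm, mul_sum]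
    refine sum_le_sum fun i _ => ?_
    have h1 : 1 - π i o = ex (bv σ) (fun t => 1 - if (fun z => U z i && t z) = o then 1 else 0) := by
      rw [ex_sub, hbσ.ex_const]
    have h2 : σ * ∑ z, (if U z i then (1 : ℝ) else 0) =
        ex (bv σ) (fun t => ∑ z, (if U z i && t z then 1 else 0)) := by
      rw [ex_sum, mul_sum]
      refine sum_congr rfl fun z _ => ?_
      rw [ex_bv_apply σ z (fun b => if U z i && b then (1 : ℝ) else 0)]
      cases U z i <;> simp
    rw [h1, h2]
    refine hbσ.ex_mono fun t => ?_
    by_cases ht : (fun z => U z i && t z) = o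
    · rw [if_pos ht]
      simp only [sub_self]
      exact sum_nonneg fun z _ => by split_ifs <;> norm_num
    · rw [if_neg ht]
      obtain ⟨z, hz⟩ := Function.ne_iff.1 ht
      have hz' : (U z i && t z) = true := by simpa [o] using hz
      have := single_le_sum (f := fun z => if U z i && t z then (1 : ℝ) else 0)
        (fun z _ => by split_ifs <;> norm_num) (mem_univ z)
      simp only [hz', if_true] at this
      linarith
  gcongr

/-! ### The random addressed function and the answers to fixed queries -/

/-- The address of `x`: its coordinates in `M`, the others replaced by `false`. -/
def mask {n : ℕ} (M x : Fin n → Bool) : Fin n → Bool := fun i => M i && x i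

/-- The function that on the subcube of inputs with address `z` is the constant `b z`, plus (if
`c z` holds) the parity of the variables in `S z ∩ A`. -/
def addrFun {n : ℕ} (M A : Fin n → Bool) (c : (Fin n → Bool) → Bool)
    (S : (Fin n → Bool) → Fin n → Bool) (b : (Fin n → Bool) → Bool) : BoolFun n :=
  fun x => b (mask M x) + c (mask M x) * ∑ i, (A i && S (mask M x) i) * x i

/-- The expectation over independent `M`, `A`, `c`, `S`, `b`. -/
noncomputable def exFun {n : ℕ} (τ p l σ : ℝ) (F : (Fin n → Bool) → (Fin n → Bool) →
    ((Fin n → Bool) → Bool) → ((Fin n → Bool) → Fin n → Bool) → ((Fin n → Bool) → Bool) → ℝ) : ℝ :=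
  ex (bv τ) fun M => ex (bv p) fun A => ex (bv l) fun c => ex (piW fun _ => bv σ) fun S =>
    ex (bv (1 / 2)) fun b => F M A c S b

theorem bool_add_self (a : Bool) : a + a = 0 := by cases a <;> rfl

theorem bool_mul_eq_and (a b : Bool) : a * b = (a && b) := rfl

open Classical in
/-- A query with address `z`, if there is one. -/
noncomputable def rep {n q : ℕ} (M : Fin n → Bool) (x : Fin q → Fin n → Bool) (z : Fin n → Bool) :
    Fin n → Bool :=
  if h : ∃ j, mask M (x j) = z then x h.choose else 0

open Classical in
/-- The coordinates in which the queries with address `z` are not all equal. -/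
noncomputable def spread {n q : ℕ} (M : Fin n → Bool) (x : Fin q → Fin n → Bool)
    (z : Fin n → Bool) (i : Fin n) : Bool :=
  decide (∃ j, mask M (x j) = z ∧ x j i ≠ rep M x z i)

/-- Uniform bits are invariant under translation. This hides the parity at a representative query
and also gives the cancellation in the second moment. -/
theorem ex_half_add {Z : Type*} [Fintype Z] [DecidableEq Z] (t : Z → Bool) (F : (Z → Bool) → ℝ) :
    ex (bv (1 / 2)) (fun b => F (b + t)) = ex (bv (1 / 2)) F := by
  have hc : ∀ b : Z → Bool, bv (1 / 2 : ℝ) b = (1 / 2) ^ Fintype.card Z := by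
    intro b
    have : ∀ a : Bool, bern (1 / 2) a = 1 / 2 := by intro a; cases a <;> norm_num [bern]
    simp only [bv, piW, this, prod_const, card_univ]
  unfold ex
  simp only [hc]
  exact Fintype.sum_equiv (Equiv.addRight t) _ _ fun b => by simp

/-- Arithmetic is in the field of two elements. The parity at the representative is absorbed into
the constant of the subcube. What remains involves only differences from the representative, so
masking by `spread` removes only zero terms. -/
theorem addrFun_query {n q : ℕ} (M A : Fin n → Bool) (c : (Fin n → Bool) → Bool)
    (S : (Fin n → Bool) → Fin n → Bool) (b : (Fin n → Bool) → Bool) (x : Fin q → Fin n → Bool)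
    (j : Fin q) :
    addrFun M A c S b (x j) =
      (b + fun z => c z * ∑ i, (A i && S z i) * rep M x z i) (mask M (x j)) +
      ∑ i, (A i && ((c (mask M (x j)) && spread M x (mask M (x j)) i) && S (mask M (x j)) i)) *
        (x j i + rep M x (mask M (x j)) i) := by
  have h : ∀ i, (A i && ((c (mask M (x j)) && spread M x (mask M (x j)) i) &&
      S (mask M (x j)) i)) * (x j i + rep M x (mask M (x j)) i) =
      c (mask M (x j)) * ((A i && S (mask M (x j)) i) * x j i) +
      c (mask M (x j)) * ((A i && S (mask M (x j)) i) * rep M x (mask M (x j)) i) := by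
    intro i
    by_cases hi : x j i = rep M x (mask M (x j)) i
    · rw [hi, bool_add_self, bool_add_self, mul_zero]
    · have : spread M x (mask M (x j)) i = true := decide_eq_true ⟨j, rfl, hi⟩
      rw [this]
      simp only [← bool_mul_eq_and]
      have h1 : (true : Bool) = 1 := rfl
      rw [h1]
      ring
  simp only [h, sum_add_distrib, ← mul_sum, Pi.add_apply, addrFun]
  set u := c (mask M (x j)) * ∑ i, (A i && S (mask M (x j)) i) * rep M x (mask M (x j)) i
  have := bool_add_self u
  calc _ = b (mask M (x j)) + c (mask M (x j)) * ∑ i, (A i && S (mask M (x j)) i) * x j i +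
        (u + u) := by rw [this, add_zero]
    _ = _ := by ring

/-- For fixed addressing variables, the answers to fixed queries hardly depend on the density of
`A`. -/
theorem abs_ex_answers_sub_le {n k : ℕ} (M : Fin n → Bool) (x : Fin k → Fin n → Bool)
    {p q η σ l : ℝ} (hσ0 : 0 ≤ σ) (hσ1 : σ ≤ 1) (hl0 : 0 ≤ l) (hl1 : l ≤ 1) (hp : 1 / 4 ≤ p)
    (hp2 : p ≤ 1 / 2) (hq : p ≤ q) (hq1 : q ≤ 1) (hη : 0 < η) {Φ : (Fin k → Bool) → ℝ}
    (hΦ : ∀ v, 0 ≤ Φ v) (hΦ1 : ∀ v, Φ v ≤ 1) :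
    |ex (bv q) (fun A => ex (bv l) fun c => ex (piW fun _ => bv σ) fun S => ex (bv (1 / 2)) fun b =>
        Φ fun j => addrFun M A c S b (x j)) -
      ex (bv p) (fun A => ex (bv l) fun c => ex (piW fun _ => bv σ) fun S => ex (bv (1 / 2)) fun b =>
        Φ fun j => addrFun M A c S b (x j))| ≤
      η / 2 + 8 * (q - p) ^ 2 * (σ * (l * ∑ z, ∑ i, if spread M x z i then 1 else 0)) / η := by
  have hlP : IsProb (bv (ι := Fin n → Bool) l) := isProb_bv hl0 hl1
  have hhP : IsProb (bv (ι := Fin n → Bool) (1 / 2)) := isProb_bv (by norm_num) (by norm_num)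
  obtain ⟨Ψ, hΨ⟩ : ∃ Ψ : ((Fin n → Bool) → Bool) → (Fin n → (Fin n → Bool) → Bool) → ℝ,
      ∀ b v, Ψ b v = Φ fun j => b (mask M (x j)) +
        ∑ i, v i (mask M (x j)) * (x j i + rep M x (mask M (x j)) i) := ⟨_, fun _ _ => rfl⟩
  have hrep : ∀ r : ℝ, ex (bv r) (fun A => ex (bv l) fun c => ex (piW fun _ => bv σ) fun S =>
      ex (bv (1 / 2)) fun b => Φ fun j => addrFun M A c S b (x j)) =
      ex (bv l) fun c => ex (bv (1 / 2)) fun b => ex (bv r) fun A => ex (piW fun _ => bv σ) fun S =>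
        Ψ b fun i z => A i && ((c z && spread M x z i) && S z i) := by
    intro r
    rw [ex_comm]
    congr 1; funext c
    rw [ex_comm (w := bv (1 / 2))]
    congr 1; funext A
    rw [ex_comm (w := bv (1 / 2))]
    congr 1; funext S
    -- For fixed `c`, `A`, `S`, the bits `b` are translated by the parities at the representatives.
    -- Afterwards `A` enters only through the masked sets.
    rw [← ex_half_add (fun z => c z * ∑ i, (A i && S z i) * rep M x z i)
      (fun b => Ψ b fun i z => A i && ((c z && spread M x z i) && S z i))]
    congr 1; funext b
    rw [hΨ]
    congr 1; funext j
    exact addrFun_query M A c S b x j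
  have hc : ∀ c : (Fin n → Bool) → Bool,
      |ex (bv (1 / 2)) fun b => ex (bv q) (fun A => ex (piW fun _ => bv σ) fun S =>
        Ψ b fun i z => A i && ((c z && spread M x z i) && S z i)) -
        ex (bv p) (fun A => ex (piW fun _ => bv σ) fun S =>
        Ψ b fun i z => A i && ((c z && spread M x z i) && S z i))| ≤
      η / 2 + 8 * (q - p) ^ 2 * σ / η * ∑ z, ∑ i, if c z && spread M x z i then 1 else 0 := by
    intro c
    refine hhP.abs_ex_le.trans (hhP.ex_le fun b => ?_)
    refine (abs_ex_masked_sub_le (fun z i => c z && spread M x z i) hσ0 hσ1 hp hp2 hq hq1 hη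
      (fun v => (hΨ b v).symm ▸ hΦ _) (fun v => (hΨ b v).symm ▸ hΦ1 _)).trans_eq ?_
    ring
  have hd : ∀ G H : ((Fin n → Bool) → Bool) → ((Fin n → Bool) → Bool) → ℝ,
      ex (bv l) (fun c => ex (bv (1 / 2)) (G c)) - ex (bv l) (fun c => ex (bv (1 / 2)) (H c)) =
      ex (bv l) fun c => ex (bv (1 / 2)) fun b => G c b - H c b := by
    intro G H
    simp only [ex_sub]
  rw [hrep, hrep, hd]
  refine hlP.abs_ex_le.trans ((hlP.ex_mono hc).trans_eq ?_)
  rw [ex_add, hlP.ex_const, ex_mul_left]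
  have : ex (bv l) (fun c => ∑ z, ∑ i, if c z && spread M x z i then (1 : ℝ) else 0) =
      l * ∑ z, ∑ i, if spread M x z i then 1 else 0 := by
    rw [ex_sum, mul_sum]
    refine sum_congr rfl fun z _ => ?_
    rw [ex_bv_apply l z (fun a => ∑ i, if a && spread M x z i then (1 : ℝ) else 0)]
    simp
  rw [this]
  ring

/-! ### Collisions of addresses -/

theorem ex_mask_eq {n : ℕ} {τ : ℝ} (x y : Fin n → Bool) :
    ex (bv τ) (fun M => ind (mask M x = mask M y)) = (1 - τ) ^ hammingDist x y := by
  have h : (fun M : Fin n → Bool => ind (mask M x = mask M y)) =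
      fun M => ∏ i, if M i ∧ x i ≠ y i then (0 : ℝ) else 1 := by
    funext M
    by_cases hM : mask M x = mask M y
    · rw [ind_true hM]
      refine (prod_eq_one fun i _ => if_neg ?_).symm
      rintro ⟨h1, h2⟩
      have := congr_fun hM i
      simp only [mask, h1, Bool.true_and] at this
      exact h2 this
    · rw [ind_false hM]
      obtain ⟨i, hi⟩ := Function.ne_iff.1 hM
      symm
      apply Finset.prod_eq_zero (mem_univ i)
      rw [if_pos]
      cases hMi : M i <;> simp_all [mask]
  rw [h, ex_bv_prod τ (fun i a => if a ∧ x i ≠ y i then (0 : ℝ) else 1), hammingDist]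
  rw [← prod_const, prod_filter]
  refine prod_congr rfl fun i _ => ?_
  by_cases hi : x i = y i <;> simp [hi]

/-- Each exposed pair is charged to a query that differs there from its representative. A query then
pays its distance to the representative: at most `L` if they are close, and at most `n` for a
collision of distant queries. -/
theorem sum_spread_le {n k : ℕ} (M : Fin n → Bool) (x : Fin k → Fin n → Bool) (L : ℕ) :
    ∑ z, ∑ i, (if spread M x z i then (1 : ℝ) else 0) ≤
      ∑ j, (L + ∑ j', (n : ℝ) *
        if L ≤ hammingDist (x j) (x j') then ind (mask M (x j) = mask M (x j')) else 0) := by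
  have h1 : ∀ z i, (if spread M x z i then (1 : ℝ) else 0) ≤
      ∑ j, if mask M (x j) = z then (if x j i ≠ rep M x z i then 1 else 0) else 0 := by
    intro z i
    by_cases h : spread M x z i
    · rw [if_pos h]
      obtain ⟨j, hj, hj2⟩ := of_decide_eq_true h
      have := single_le_sum (f := fun j => if mask M (x j) = z then
        (if x j i ≠ rep M x z i then (1 : ℝ) else 0) else 0)
        (fun z _ => by split_ifs <;> norm_num) (mem_univ j)
      simp only [hj, hj2, if_true, ne_eq, not_false_eq_true] at this
      exact this
    · rw [if_neg h]
      exact sum_nonneg fun z _ => by split_ifs <;> norm_num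
  have h2 : ∀ j, (∑ z, ∑ i, if mask M (x j) = z then
      (if x j i ≠ rep M x z i then (1 : ℝ) else 0) else 0) =
      hammingDist (x j) (rep M x (mask M (x j))) := by
    intro j
    rw [Finset.sum_eq_single (mask M (x j))]
    · simp only [if_true, hammingDist, sum_boole]
    · intro z _ hz; simp [hz.symm]
    · simp
  calc _ ≤ ∑ z, ∑ i, ∑ j, (if mask M (x j) = z then
        (if x j i ≠ rep M x z i then (1 : ℝ) else 0) else 0) :=
        sum_le_sum fun z _ => sum_le_sum fun i _ => h1 z i
    _ = ∑ j, ((hammingDist (x j) (rep M x (mask M (x j))) : ℕ) : ℝ) := by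
        simp only [← h2]
        rw [sum_comm]
        refine (sum_congr rfl fun i _ => sum_comm).trans ?_
        rw [sum_comm]
        exact sum_congr rfl fun j _ => sum_comm
    _ ≤ _ := by
        refine sum_le_sum fun j _ => ?_
        have hex : ∃ j', mask M (x j') = mask M (x j) := ⟨j, rfl⟩
        have hr : rep M x (mask M (x j)) = x hex.choose := dif_pos hex
        rw [hr]
        have hm := hex.choose_spec
        set j' := hex.choose
        have hnn : ∀ j', 0 ≤ (n : ℝ) *
            if L ≤ hammingDist (x j) (x j') then ind (mask M (x j) = mask M (x j')) else 0 := by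
          intro j'
          have := ind_nonneg (mask M (x j) = mask M (x j'))
          split_ifs <;> positivity
        have hS := sum_nonneg fun j' (_ : j' ∈ univ) => hnn j'
        by_cases hL : L ≤ hammingDist (x j) (x j')
        · have h3 := single_le_sum (fun j' _ => hnn j') (mem_univ j')
          rw [if_pos hL, ind_true hm.symm, mul_one] at h3
          have h4 : (hammingDist (x j) (x j') : ℝ) ≤ n := by
            have := hammingDist_le_card_fintype (x := x j) (y := x j')
            rw [Fintype.card_fin] at this
            exact_mod_cast this
          have : (0 : ℝ) ≤ L := by positivity
          linarith
        · have : (hammingDist (x j) (x j') : ℝ) ≤ L := by exact_mod_cast (not_le.1 hL).le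
          linarith

theorem ex_sum_spread_le {n k : ℕ} {τ : ℝ} (h0 : 0 ≤ τ) (h1 : τ ≤ 1) (x : Fin k → Fin n → Bool)
    (L : ℕ) :
    ex (bv τ) (fun M => ∑ z, ∑ i, (if spread M x z i then (1 : ℝ) else 0)) ≤
      k * L + k ^ 2 * n * (1 - τ) ^ L := by
  have hτ : IsProb (bv (ι := Fin n) τ) := isProb_bv h0 h1
  refine (hτ.ex_mono fun M => sum_spread_le M x L).trans ?_
  rw [ex_sum]
  have h : ∀ j, ex (bv τ) (fun M => (L : ℝ) + ∑ j', (n : ℝ) *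
      if L ≤ hammingDist (x j) (x j') then ind (mask M (x j) = mask M (x j')) else 0) ≤
      L + k * (n * (1 - τ) ^ L) := by
    intro j
    rw [ex_add, hτ.ex_const, ex_sum]
    have : ∀ j', ex (bv τ) (fun M => (n : ℝ) *
        if L ≤ hammingDist (x j) (x j') then ind (mask M (x j) = mask M (x j')) else 0) ≤
        n * (1 - τ) ^ L := by
      intro j'
      rw [ex_mul_left]
      refine mul_le_mul_of_nonneg_left ?_ (by positivity)
      by_cases hL : L ≤ hammingDist (x j) (x j')
      · simp only [hL, if_true]
        rw [ex_mask_eq]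
        exact pow_le_pow_of_le_one (by linarith) (by linarith) hL
      · simp only [hL, if_false]
        rw [hτ.ex_const]
        have : 0 ≤ 1 - τ := by linarith
        positivity
    have := sum_le_sum fun j' (_ : j' ∈ univ) => this j'
    simp only [sum_const, card_univ, Fintype.card_fin, nsmul_eq_mul] at this
    linarith
  have := sum_le_sum fun j (_ : j ∈ univ) => h j
  simp only [sum_const, card_univ, Fintype.card_fin, nsmul_eq_mul] at this
  refine this.trans_eq ?_
  ring

/-- A few fixed queries hardly distinguish the two densities of `A`. -/
theorem abs_exFun_answers_sub_le {n k : ℕ} (x : Fin k → Fin n → Bool) {τ p q η σ l : ℝ}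
    (hτ0 : 0 ≤ τ) (hτ1 : τ ≤ 1) (hσ0 : 0 ≤ σ) (hσ1 : σ ≤ 1) (hl0 : 0 ≤ l) (hl1 : l ≤ 1)
    (hp : 1 / 4 ≤ p) (hp2 : p ≤ 1 / 2) (hq : p ≤ q) (hq1 : q ≤ 1) (hη : 0 < η)
    {Φ : (Fin k → Bool) → ℝ} (hΦ : ∀ v, 0 ≤ Φ v) (hΦ1 : ∀ v, Φ v ≤ 1) (L : ℕ) :
    |exFun τ q l σ (fun M A c S b => Φ fun j => addrFun M A c S b (x j)) -
      exFun τ p l σ (fun M A c S b => Φ fun j => addrFun M A c S b (x j))| ≤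
      η / 2 + 8 * (q - p) ^ 2 * (σ * (l * (k * L + k ^ 2 * n * (1 - τ) ^ L))) / η := by
  have hτ : IsProb (bv (ι := Fin n) τ) := isProb_bv hτ0 hτ1
  unfold exFun
  rw [← ex_sub]
  refine hτ.abs_ex_le.trans ((hτ.ex_mono fun M => abs_ex_answers_sub_le M x hσ0 hσ1 hl0 hl1 hp hp2
    hq hq1 hη hΦ hΦ1).trans ?_)
  have : (fun M => η / 2 + 8 * (q - p) ^ 2 *
      (σ * (l * ∑ z, ∑ i, if spread M x z i then (1 : ℝ) else 0)) / η) =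
      fun M => η / 2 + 8 * (q - p) ^ 2 * σ * l / η *
        ∑ z, ∑ i, if spread M x z i then (1 : ℝ) else 0 := by
    funext M; ring
  rw [this, ex_add, hτ.ex_const, ex_mul_left]
  have h1 := mul_le_mul_of_nonneg_left (ex_sum_spread_le hτ0 hτ1 x L)
    (show 0 ≤ 8 * (q - p) ^ 2 * σ * l / η by positivity)
  refine (add_le_add_right h1 _).trans_eq ?_
  ring

/-! ### Juntas, flips and counting in subcubes -/

theorem isJunta_of_forall {n k : ℕ} {f : BoolFun n} (s : Finset (Fin n)) (hs : s.card ≤ k)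
    (h : ∀ x y : Fin n → Bool, (∀ i ∈ s, x i = y i) → f x = f y) : IsJunta k f := by
  refine ⟨s, hs, fun y => f fun i => if hi : i ∈ s then y ⟨i, hi⟩ else false, fun x => ?_⟩
  refine h _ _ fun i hi => ?_
  simp [hi]

theorem isJunta_addrFun {n k : ℕ} {M A : Fin n → Bool} (c : (Fin n → Bool) → Bool)
    (S : (Fin n → Bool) → Fin n → Bool) (b : (Fin n → Bool) → Bool)
    (h : #{i | (M i || A i) = true} ≤ k) : IsJunta k (addrFun M A c S b) := by
  refine isJunta_of_forall _ h fun x y hxy => ?_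
  have h0 : ∀ i, M i = true ∨ A i = true → x i = y i := by simpa using hxy
  have hm : mask M x = mask M y := by
    funext i
    cases hM : M i
    · simp [mask, hM]
    · simp [mask, h0 i (Or.inl hM)]
  unfold addrFun
  rw [hm]
  congr 2
  refine sum_congr rfl fun i _ => ?_
  cases hA : A i
  · simp only [Bool.false_and]
    exact (zero_mul _).trans (zero_mul _).symm
  · rw [h0 i (Or.inr hA)]

/-- `x` with the coordinate `i` flipped. -/
def flip {n : ℕ} (i : Fin n) (x : Fin n → Bool) : Fin n → Bool := Function.update x i (!x i)

theorem flip_flip {n : ℕ} (i : Fin n) (x : Fin n → Bool) : flip i (flip i x) = x := by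
  simp [flip]

theorem flip_self {n : ℕ} (i : Fin n) (x : Fin n → Bool) : flip i x i = !x i := by simp [flip]

theorem flip_of_ne {n : ℕ} {i j : Fin n} (h : j ≠ i) (x : Fin n → Bool) : flip i x j = x j := by
  simp [flip, h]

theorem mask_flip {n : ℕ} {M : Fin n → Bool} {i : Fin n} (h : M i = false) (x : Fin n → Bool) :
    mask M (flip i x) = mask M x := by
  funext j
  by_cases hj : j = i
  · subst hj; simp [mask, h]
  · simp [mask, flip_of_ne hj]

theorem mask_mask {n : ℕ} (M x : Fin n → Bool) : mask M (mask M x) = mask M x := by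
  funext j; simp [mask]

/-- If `t` pairs up the points of `G` so that `f` differs and `g` agrees on each pair, then `f` and
`g` disagree on at least half of `G`. -/
theorem card_le_two_mul_hammingDist {n : ℕ} (f g : BoolFun n) (G : Finset (Fin n → Bool))
    (t : (Fin n → Bool) → Fin n → Bool) (ht : ∀ x ∈ G, t x ∈ G) (htt : ∀ x ∈ G, t (t x) = x)
    (hf : ∀ x ∈ G, f (t x) ≠ f x) (hg : ∀ x ∈ G, g (t x) = g x) :
    #G ≤ 2 * hammingDist f g := by
  have h1 : #G ≤ ∑ x ∈ G, ((if f x ≠ g x then 1 else 0) + if f (t x) ≠ g (t x) then 1 else 0) := by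
    rw [card_eq_sum_ones]
    refine sum_le_sum fun x hx => ?_
    have a1 := hf x hx
    rw [hg x hx]
    by_cases h : f x = g x
    · rw [if_neg (not_not.2 h), if_pos]
      rw [← h]; exact a1
    · rw [if_pos h]; omega
  have h2 : ∑ x ∈ G, (if f (t x) ≠ g (t x) then 1 else 0) = ∑ x ∈ G, if f x ≠ g x then 1 else 0 :=
    sum_bij' (fun x _ => t x) (fun x _ => t x) ht ht htt htt fun _ _ => rfl
  have h3 : ∑ x ∈ G, (if f x ≠ g x then 1 else 0) ≤ hammingDist f g := by
    rw [hammingDist, card_filter]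
    exact sum_le_sum_of_subset (subset_univ G)
  rw [sum_add_distrib, h2] at h1
  omega

/-- The number of points that agree with `x` on the coordinates satisfying `P`. -/
theorem card_agree {n : ℕ} (P : Fin n → Prop) [DecidablePred P] (x : Fin n → Bool) :
    (#{y : Fin n → Bool | ∀ j, P j → y j = x j}) * 2 ^ #{j | P j} = 2 ^ n := by
  have h : ({y : Fin n → Bool | ∀ j, P j → y j = x j} : Finset _) =
      Fintype.piFinset fun j => if P j then {x j} else univ := by
    ext y
    simp only [mem_filter, mem_univ, true_and, Fintype.mem_piFinset]
    refine forall_congr' fun j => ?_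
    by_cases hj : P j <;> simp [hj]
  rw [h, Fintype.card_piFinset, ← prod_const, prod_filter, ← prod_mul_distrib]
  have : ∀ j, #(if P j then {x j} else (univ : Finset Bool)) * (if P j then 2 else 1) = 2 := by
    intro j
    by_cases hj : P j <;> simp [hj]
  exact (prod_congr rfl fun j _ => this j).trans (by simp)

theorem mask_eq_iff {n : ℕ} {M z : Fin n → Bool} (hz : mask M z = z) (x : Fin n → Bool) :
    mask M x = z ↔ ∀ j, M j = true → x j = z j := by
  rw [← hz, funext_iff]
  refine forall_congr' fun j => ?_
  cases h : M j <;> simp [mask, h]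

theorem card_fiber_mask {n : ℕ} {M z : Fin n → Bool} (hz : mask M z = z) :
    #{x | mask M x = z} * 2 ^ #{j | M j = true} = 2 ^ n := by
  rw [← card_agree (fun j => M j = true) z]
  simp only [mask_eq_iff hz]

theorem card_addresses {n : ℕ} (M : Fin n → Bool) :
    #{z | mask M z = z} = 2 ^ #{j | M j = true} := by
  have h := card_eq_sum_card_fiberwise (f := mask M) (s := univ) (t := {z | mask M z = z})
    fun x _ => by simp [mask_mask]
  have h2 : (∑ z ∈ ({z | mask M z = z} : Finset _), #{x | mask M x = z}) * 2 ^ #{j | M j = true} =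
      #{z | mask M z = z} * 2 ^ n := by
    rw [sum_mul, ← smul_eq_mul, ← sum_const]
    refine sum_congr rfl fun z hz => ?_
    exact card_fiber_mask (by simpa using hz)
  rw [← h] at h2
  simp only [card_univ, Fintype.card_pi, Fintype.card_bool, prod_const, Fintype.card_fin] at h2
  have : 0 < 2 ^ n := by positivity
  exact (Nat.eq_of_mul_eq_mul_left this (by rw [h2, mul_comm])).symm

/-! ### Concentration of the sizes of `M` and `M ∪ A` -/

section chernoff

theorem mul_exp_add_pow_le {r θ : ℝ} (n : ℕ) (hr0 : 0 ≤ r) (hr1 : r ≤ 1) (hθ : |θ| ≤ 1) :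
    (r * Real.exp θ + (1 - r)) ^ n ≤ Real.exp (n * (r * θ + θ ^ 2)) := by
  rw [Real.exp_nat_mul]
  have := Real.exp_pos θ
  have h1 : 0 ≤ r * Real.exp θ + (1 - r) := by nlinarith
  refine pow_le_pow_left₀ h1 ?_ n
  have h2 := exp_le_one_add_add_sq hθ
  have h3 := Real.add_one_le_exp (r * θ + θ ^ 2)
  nlinarith [sq_nonneg θ]

theorem abs_inv_sqrt_le {n : ℕ} (hn : 1 ≤ n) : |1 / √(n : ℝ)| ≤ 1 := by
  have : 1 ≤ √(n : ℝ) := by rw [Real.one_le_sqrt]; exact_mod_cast hn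
  rw [abs_of_nonneg (by positivity), div_le_one (by linarith)]
  exact this

variable {n : ℕ} {τ p t : ℝ}

theorem ex_exp_union (θ : ℝ) :
    ex (bv τ) (fun M : Fin n → Bool => ex (bv p) fun A : Fin n → Bool =>
      Real.exp (θ * #{i | (M i || A i) = true})) =
    ((1 - (1 - τ) * (1 - p)) * Real.exp θ + (1 - (1 - (1 - τ) * (1 - p)))) ^ n := by
  have h : ∀ M A : Fin n → Bool, Real.exp (θ * #{i | (M i || A i) = true}) =
      ∏ i, if (M i || A i) = true then Real.exp θ else 1 := by
    intro M A
    rw [← prod_filter, prod_const, ← Real.exp_nat_mul, mul_comm]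
  simp only [h]
  have h2 : ∀ M : Fin n → Bool, ex (bv p) (fun A : Fin n → Bool =>
      ∏ i, if (M i || A i) = true then Real.exp θ else 1) =
      ∏ i, if M i = true then Real.exp θ else p * Real.exp θ + (1 - p) := by
    intro M
    rw [ex_bv_prod p fun i a => if (M i || a) = true then Real.exp θ else 1]
    refine prod_congr rfl fun i _ => ?_
    cases M i <;> simp
    ring
  simp only [h2]
  rw [ex_bv_prod τ fun _ a => if a = true then Real.exp θ else p * Real.exp θ + (1 - p)]
  simp only [prod_const, card_univ, Fintype.card_fin, if_true, Bool.false_eq_true, if_false]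
  congr 1
  ring

theorem union_density_mem (hτ0 : 0 ≤ τ) (hτ1 : τ ≤ 1) (hp0 : 0 ≤ p) (hp1 : p ≤ 1) :
    0 ≤ 1 - (1 - τ) * (1 - p) ∧ 1 - (1 - τ) * (1 - p) ≤ 1 := by
  constructor <;> nlinarith

theorem mul_div_sqrt_sq (hn : 1 ≤ n) : (n : ℝ) * (1 / √(n : ℝ)) ^ 2 = 1 := by
  have : (0 : ℝ) < n := by exact_mod_cast hn
  rw [div_pow, Real.sq_sqrt this.le]; field_simp

theorem ex_union_upper (hn : 1 ≤ n) (hτ0 : 0 ≤ τ) (hτ1 : τ ≤ 1) (hp0 : 0 ≤ p) (hp1 : p ≤ 1) :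
    ex (bv τ) (fun M : Fin n → Bool => ex (bv p) fun A : Fin n → Bool =>
      ind ((1 - (1 - τ) * (1 - p)) * n + t * √n ≤ (#{i | (M i || A i) = true} : ℝ))) ≤
    Real.exp (1 - t) := by
  obtain ⟨hr0, hr1⟩ := union_density_mem hτ0 hτ1 hp0 hp1
  set r := 1 - (1 - τ) * (1 - p)
  have hn' : (0 : ℝ) < n := by exact_mod_cast hn
  have hs : 0 < √(n : ℝ) := Real.sqrt_pos.2 hn'
  -- This choice makes the quadratic term `n * θ ^ 2` equal to `1` and the deviation term equal to
  -- `t`, whence `exp (1 - t)`.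
  set θ := 1 / √(n : ℝ) with hθ
  have hθ0 : 0 < θ := by positivity
  have hθs : θ * √n = 1 := by rw [hθ]; field_simp
  have h1 : ∀ M : Fin n → Bool, ex (bv p) (fun A : Fin n → Bool =>
      ind (r * n + t * √n ≤ (#{i | (M i || A i) = true} : ℝ))) ≤
      Real.exp (-(θ * (r * n + t * √n))) * ex (bv p) fun A : Fin n → Bool =>
        Real.exp (θ * #{i | (M i || A i) = true}) := by
    intro M
    rw [← ex_mul_left]
    simp only [← Real.exp_add]
    refine (isProb_bv hp0 hp1).ex_ind_le_exp _ _ fun A hA => ?_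
    nlinarith
  refine ((isProb_bv hτ0 hτ1).ex_mono h1).trans ?_
  rw [ex_mul_left, ex_exp_union]
  refine (mul_le_mul_of_nonneg_left (mul_exp_add_pow_le n hr0 hr1 (abs_inv_sqrt_le hn))
    (Real.exp_pos _).le).trans_eq ?_
  rw [← Real.exp_add, ← hθ]
  congr 1
  have := mul_div_sqrt_sq hn
  rw [← hθ] at this
  linear_combination this - t * hθs

theorem ex_union_lower (hn : 1 ≤ n) (hτ0 : 0 ≤ τ) (hτ1 : τ ≤ 1) (hp0 : 0 ≤ p) (hp1 : p ≤ 1) :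
    ex (bv τ) (fun M : Fin n → Bool => ex (bv p) fun A : Fin n → Bool =>
      ind ((#{i | (M i || A i) = true} : ℝ) ≤ (1 - (1 - τ) * (1 - p)) * n - t * √n)) ≤
    Real.exp (1 - t) := by
  obtain ⟨hr0, hr1⟩ := union_density_mem hτ0 hτ1 hp0 hp1
  set r := 1 - (1 - τ) * (1 - p)
  have hn' : (0 : ℝ) < n := by exact_mod_cast hn
  have hs : 0 < √(n : ℝ) := Real.sqrt_pos.2 hn'
  set θ := 1 / √(n : ℝ) with hθ
  have hθ0 : 0 < θ := by positivity
  have hθs : θ * √n = 1 := by rw [hθ]; field_simp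
  have h1 : ∀ M : Fin n → Bool, ex (bv p) (fun A : Fin n → Bool =>
      ind ((#{i | (M i || A i) = true} : ℝ) ≤ r * n - t * √n)) ≤
      Real.exp (θ * (r * n - t * √n)) * ex (bv p) fun A : Fin n → Bool =>
        Real.exp (-θ * #{i | (M i || A i) = true}) := by
    intro M
    rw [← ex_mul_left]
    simp only [← Real.exp_add]
    refine (isProb_bv hp0 hp1).ex_ind_le_exp _ _ fun A hA => ?_
    nlinarith
  refine ((isProb_bv hτ0 hτ1).ex_mono h1).trans ?_
  rw [ex_mul_left, ex_exp_union]
  refine (mul_le_mul_of_nonneg_left (mul_exp_add_pow_le n hr0 hr1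
    (by rw [abs_neg]; exact abs_inv_sqrt_le hn)) (Real.exp_pos _).le).trans_eq ?_
  rw [← Real.exp_add]
  congr 1
  have := mul_div_sqrt_sq hn
  rw [← hθ] at this
  linear_combination this - t * hθs

/-- The case of density `0` for `A`: the union is then `M` almost surely. -/
theorem ex_card_lower (hn : 1 ≤ n) (hτ0 : 0 ≤ τ) (hτ1 : τ ≤ 1) :
    ex (bv τ) (fun M : Fin n → Bool => ind ((#{i | M i = true} : ℝ) ≤ τ * n - t * √n)) ≤
    Real.exp (1 - t) := by
  have h := ex_union_lower (p := 0) (t := t) hn hτ0 hτ1 le_rfl zero_le_one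
  refine le_trans ((isProb_bv hτ0 hτ1).ex_mono fun M => ?_) h
  have h0 : ex (bv (0 : ℝ)) (fun A : Fin n → Bool =>
      ind ((#{i | (M i || A i) = true} : ℝ) ≤ (1 - (1 - τ) * (1 - 0)) * n - t * √n)) =
      ind ((#{i | (M i || false) = true} : ℝ) ≤ (1 - (1 - τ) * (1 - 0)) * n - t * √n) := by
    unfold ex
    rw [Finset.sum_eq_single (fun _ => false)]
    · simp [bv, piW, bern]
    · intro A _ hA
      obtain ⟨i, hi⟩ := Function.ne_iff.1 hA
      have : bv (0 : ℝ) A = 0 := by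
        unfold bv piW
        apply Finset.prod_eq_zero (mem_univ i)
        have : A i = true := by simpa using hi
        simp [bern, this]
      rw [this, zero_mul]
    · simp
  rw [h0]
  refine ind_mono fun h => ?_
  simpa using h

end chernoff

/-! ### Calculus of the fivefold expectation -/

section exFun
variable {n : ℕ} {τ p l σ : ℝ} {F G : (Fin n → Bool) → (Fin n → Bool) →
    ((Fin n → Bool) → Bool) → ((Fin n → Bool) → Fin n → Bool) → ((Fin n → Bool) → Bool) → ℝ}

/-- All the Bernoulli parameters lie in `[0, 1]`. -/
def Params (τ p l σ : ℝ) : Prop :=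
  (0 ≤ τ ∧ τ ≤ 1) ∧ (0 ≤ p ∧ p ≤ 1) ∧ (0 ≤ l ∧ l ≤ 1) ∧ (0 ≤ σ ∧ σ ≤ 1)

theorem isProb_half {Z : Type*} [Fintype Z] [DecidableEq Z] : IsProb (bv (ι := Z) (1 / 2)) :=
  isProb_bv (by norm_num) (by norm_num)

theorem Params.isProb_S (h : Params τ p l σ) :
    IsProb (piW fun _ : Fin n → Bool => bv (ι := Fin n) σ) :=
  .piW fun _ => isProb_bv h.2.2.2.1 h.2.2.2.2

theorem Params.mono (h : Params τ p l σ) (hF : ∀ M A c S b, F M A c S b ≤ G M A c S b) :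
    exFun τ p l σ F ≤ exFun τ p l σ G :=
  (isProb_bv h.1.1 h.1.2).ex_mono fun _ => (isProb_bv h.2.1.1 h.2.1.2).ex_mono fun _ =>
    (isProb_bv h.2.2.1.1 h.2.2.1.2).ex_mono fun _ => h.isProb_S.ex_mono fun _ =>
      isProb_half.ex_mono fun _ => hF _ _ _ _ _

theorem Params.exFun_const (h : Params τ p l σ) (a : ℝ) :
    exFun (n := n) τ p l σ (fun _ _ _ _ _ => a) = a := by
  unfold exFun
  simp only [isProb_half.ex_const, h.isProb_S.ex_const,
    (isProb_bv h.2.2.1.1 h.2.2.1.2).ex_const, (isProb_bv h.2.1.1 h.2.1.2).ex_const,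
    (isProb_bv h.1.1 h.1.2).ex_const]

theorem Params.exFun_eq₂ (h : Params τ p l σ) (H : (Fin n → Bool) → (Fin n → Bool) → ℝ) :
    exFun τ p l σ (fun M A _ _ _ => H M A) = ex (bv τ) fun M => ex (bv p) fun A => H M A := by
  unfold exFun
  simp only [isProb_half.ex_const, h.isProb_S.ex_const,
    (isProb_bv h.2.2.1.1 h.2.2.1.2).ex_const]

theorem exFun_add : exFun τ p l σ (fun M A c S b => F M A c S b + G M A c S b) =
    exFun τ p l σ F + exFun τ p l σ G := by
  simp only [exFun, ex_add]

theorem exFun_sub : exFun τ p l σ (fun M A c S b => F M A c S b - G M A c S b) =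
    exFun τ p l σ F - exFun τ p l σ G := by
  simp only [exFun, ex_sub]

theorem exFun_mul_left (a : ℝ) : exFun τ p l σ (fun M A c S b => a * F M A c S b) =
    a * exFun τ p l σ F := by
  simp only [exFun, ex_mul_left]

theorem exFun_sum {κ : Type*} (s : Finset κ) (F : κ → (Fin n → Bool) → (Fin n → Bool) →
    ((Fin n → Bool) → Bool) → ((Fin n → Bool) → Fin n → Bool) → ((Fin n → Bool) → Bool) → ℝ) :
    exFun τ p l σ (fun M A c S b => ∑ j ∈ s, F j M A c S b) = ∑ j ∈ s, exFun τ p l σ (F j) := by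
  simp only [exFun, ex_sum]

theorem Params.exFun_le_of₄ (h : Params τ p l σ) {a : ℝ}
    (hF : ∀ M A c S, ex (bv (1 / 2)) (F M A c S) ≤ a) : exFun τ p l σ F ≤ a :=
  (isProb_bv h.1.1 h.1.2).ex_le fun _ => (isProb_bv h.2.1.1 h.2.1.2).ex_le fun _ =>
    (isProb_bv h.2.2.1.1 h.2.2.1.2).ex_le fun _ => h.isProb_S.ex_le fun _ => hF _ _ _ _

theorem Params.exFun_le_of₂ (h : Params τ p l σ) {a : ℝ}
    (hF : ∀ M A, ex (bv l) (fun c => ex (piW fun _ => bv σ) fun S =>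
      ex (bv (1 / 2)) (F M A c S)) ≤ a) : exFun τ p l σ F ≤ a :=
  (isProb_bv h.1.1 h.1.2).ex_le fun _ => (isProb_bv h.2.1.1 h.2.1.2).ex_le fun _ => hF _ _

end exFun

/-! ### Influence of the addressing variables -/

section secondMoment
variable {n : ℕ} (M A : Fin n → Bool) (c : (Fin n → Bool) → Bool)
    (S : (Fin n → Bool) → Fin n → Bool)

/-- The sign `(-1)^a`. -/
def sg (a : Bool) : ℝ := if a then -1 else 1

theorem sg_add_true (a : Bool) : sg (a + true) = -sg a := by
  cases a <;> simp [sg, show (true + true : Bool) = false from rfl,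
    show (false + true : Bool) = true from rfl]

theorem sg_mul (a b : Bool) : sg a * sg b = 1 - 2 * if a ≠ b then 1 else 0 := by
  cases a <;> cases b <;> simp [sg] <;> norm_num

theorem addrFun_add_single (b : (Fin n → Bool) → Bool) (z x : Fin n → Bool) :
    addrFun M A c S (b + fun w => decide (w = z)) x =
      addrFun M A c S b x + decide (mask M x = z) := by
  simp only [addrFun, Pi.add_apply]; ring

/-- The address of `x` differs from those of `flip i x`, `y` and `flip i y`. Negating the constant
at that address alone preserves the law of `b` and reverses the sign of the product. -/
theorem ex_sg_mul_eq_zero {i : Fin n} (hi : M i = true) {x y : Fin n → Bool}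
    (hxy : ¬ ∀ j, (M j = true ∧ j ≠ i) → y j = x j) :
    ex (bv (1 / 2)) (fun b => (sg (addrFun M A c S b x) * sg (addrFun M A c S b (flip i x))) *
      (sg (addrFun M A c S b y) * sg (addrFun M A c S b (flip i y)))) = 0 := by
  push Not at hxy
  obtain ⟨j, ⟨hj, hji⟩, hne⟩ := hxy
  have h := ex_half_add (fun w => decide (w = mask M x)) (fun b =>
    (sg (addrFun M A c S b x) * sg (addrFun M A c S b (flip i x))) *
      (sg (addrFun M A c S b y) * sg (addrFun M A c S b (flip i y))))
  have h1 : mask M (flip i x) ≠ mask M x := by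
    intro h
    have := congr_fun h i
    simp [mask, hi, flip_self] at this
  have h2 : mask M y ≠ mask M x := by
    intro h
    have := congr_fun h j
    simp only [mask, hj, Bool.true_and] at this
    exact hne this
  have h3 : mask M (flip i y) ≠ mask M x := by
    intro h
    have := congr_fun h j
    simp only [mask, hj, Bool.true_and, flip_of_ne hji] at this
    exact hne this
  have a0 : ∀ a : Bool, a + false = a := fun a => add_zero a
  simp only [addrFun_add_single, h1, h2, h3, decide_true, decide_false, a0, sg_add_true] at h
  set F := fun b => (sg (addrFun M A c S b x) * sg (addrFun M A c S b (flip i x))) *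
      (sg (addrFun M A c S b y) * sg (addrFun M A c S b (flip i y))) with hF
  have h4 : ex (bv (1 / 2)) (fun b => (-1) * F b) = ex (bv (1 / 2)) F := by
    rw [← h]
    congr 1; funext b
    rw [hF]; ring
  rw [ex_mul_left] at h4
  linarith

/-- An addressing variable is very likely to be influential. -/
theorem ex_ind_flip_le {i : Fin n} (hi : M i = true) :
    ex (bv (1 / 2)) (fun b => ind ((#{x | addrFun M A c S b x ≠ addrFun M A c S b (flip i x)} : ℝ) <
      2 ^ n / 3)) ≤ 18 / 2 ^ #{j | M j = true} := by
  let Y : ((Fin n → Bool) → Bool) → (Fin n → Bool) → ℝ := fun b x =>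
    sg (addrFun M A c S b x) * sg (addrFun M A c S b (flip i x))
  have hY : ∀ b, ∑ x, Y b x =
      2 ^ n - 2 * #{x | addrFun M A c S b x ≠ addrFun M A c S b (flip i x)} := by
    intro b
    simp only [Y, sg_mul, sum_sub_distrib, ← mul_sum, sum_boole]
    simp
  have hagree : ∀ x : Fin n → Bool, (#{y : Fin n → Bool | ∀ j, (M j = true ∧ j ≠ i) → y j = x j} : ℝ)
      = 2 ^ n * 2 / 2 ^ #{j | M j = true} := by
    intro x
    have h1 := card_agree (fun j => M j = true ∧ j ≠ i) x
    have h2 : #{j | M j = true} = #{j | M j = true ∧ j ≠ i} + 1 := by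
      rw [← Finset.card_erase_add_one (s := {j | M j = true}) (a := i) (by simp [hi])]
      congr 2
      ext j; simp [and_comm]
    rw [h2, eq_div_iff (by positivity), pow_succ, ← mul_assoc]
    congr 1
    exact_mod_cast h1
  -- Only pairs that agree on `M` outside `i` contribute to the second moment, each at most `1`.
  have hsq : ex (bv (1 / 2)) (fun b => (∑ x, Y b x) ^ 2) ≤
      2 ^ n * (2 ^ n * 2 / 2 ^ #{j | M j = true}) := by
    simp only [sq, sum_mul_sum]
    rw [ex_sum]
    simp only [ex_sum]
    have : ∀ x y, ex (bv (1 / 2)) (fun b => Y b x * Y b y) ≤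
        if ∀ j, (M j = true ∧ j ≠ i) → y j = x j then 1 else 0 := by
      intro x y
      split_ifs with hxy
      · refine isProb_half.ex_le fun b => ?_
        simp only [Y, sg_mul]
        split_ifs <;> norm_num
      · exact (ex_sg_mul_eq_zero M A c S hi hxy).le
    refine (sum_le_sum fun x _ => sum_le_sum fun y _ => this x y).trans ?_
    simp only [sum_boole, hagree]
    simp
  -- Chebyshev: fewer than `2 ^ n / 3` sensitive points force the sum of signs above `2 ^ n / 3`.
  have hmark : ∀ b, ind ((#{x | addrFun M A c S b x ≠ addrFun M A c S b (flip i x)} : ℝ) <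
      2 ^ n / 3) ≤ 9 / (2 ^ n * 2 ^ n) * (∑ x, Y b x) ^ 2 := by
    intro b
    refine ind_le_of (by positivity) fun h => ?_
    rw [hY b]
    set N := (#{x | addrFun M A c S b x ≠ addrFun M A c S b (flip i x)} : ℝ)
    have h2 : (0 : ℝ) < 2 ^ n := by positivity
    rw [div_mul_eq_mul_div, one_le_div (by positivity)]
    nlinarith
  refine (isProb_half.ex_mono hmark).trans ?_
  rw [ex_mul_left]
  refine (mul_le_mul_of_nonneg_left hsq (by positivity)).trans_eq ?_
  field_simp
  norm_num

end secondMoment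

/-! ### Subcubes whose parity meets a given set of variables -/

theorem ex_exp_meet {n : ℕ} (D : Finset (Fin n)) {σ : ℝ} (hσ0 : 0 ≤ σ) (hσ1 : σ ≤ 1) (a : ℝ) :
    ex (bv σ) (fun s : Fin n → Bool => if ∃ i ∈ D, s i = true then a else 1) =
      a + (1 - a) * (1 - σ) ^ #D := by
  have h : (fun s : Fin n → Bool => if ∃ i ∈ D, s i = true then a else 1) =
      fun s => a + (1 - a) * ∏ i, if i ∈ D then (if s i then 0 else 1) else 1 := by
    funext s
    by_cases hs : ∃ i ∈ D, s i = true
    · rw [if_pos hs]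
      obtain ⟨i, hi, hsi⟩ := hs
      have : ∏ i, (if i ∈ D then (if s i then (0 : ℝ) else 1) else 1) = 0 := by
        apply Finset.prod_eq_zero (mem_univ i)
        simp [hi, hsi]
      rw [this]; ring
    · rw [if_neg hs]
      push Not at hs
      have : ∏ i, (if i ∈ D then (if s i then (0 : ℝ) else 1) else 1) = 1 := by
        refine prod_eq_one fun i _ => ?_
        by_cases hi : i ∈ D
        · simp [hi, hs i hi]
        · simp [hi]
      rw [this]; ring
  rw [h, ex_add, (isProb_bv hσ0 hσ1).ex_const, ex_mul_left,
    ex_bv_prod σ fun i b => if i ∈ D then (if b then (0 : ℝ) else 1) else 1]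
  congr 2
  have : ∀ i, (σ * (if i ∈ D then (if true = true then (0 : ℝ) else 1) else 1) +
      (1 - σ) * if i ∈ D then (if false = true then (0 : ℝ) else 1) else 1) =
      if i ∈ D then 1 - σ else 1 := by
    intro i; split_ifs <;> simp_all
  rw [prod_congr rfl fun i _ => this i, prod_ite_mem, univ_inter, prod_const]

/-- Unless the variables in `D` are few, most of the subcubes that carry a parity involve one of
them. -/
theorem ex_ind_parity_le {n : ℕ} (M : Fin n → Bool) (D : Finset (Fin n)) {l σ : ℝ} (hl0 : 0 ≤ l)
    (hl1 : l ≤ 1) (hσ0 : 0 ≤ σ) (hσ1 : σ ≤ 1) (hD : (1 - σ) ^ #D ≤ 1 / 20) :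
    ex (bv l) (fun c => ex (piW fun _ => bv σ) fun S : (Fin n → Bool) → Fin n → Bool =>
      ind ((#{x | c (mask M x) = true ∧ ∃ i ∈ D, S (mask M x) i = true} : ℝ) < l / 3 * 2 ^ n)) ≤
    Real.exp (-(l * 2 ^ #{j | M j = true} / 4)) := by
  have hl : IsProb (bv (ι := Fin n → Bool) l) := isProb_bv hl0 hl1
  have hS : IsProb (piW fun _ : Fin n → Bool => bv (ι := Fin n) σ) :=
    .piW fun _ => isProb_bv hσ0 hσ1
  set N : ℝ := 2 ^ #{j | M j = true} with hN
  have hN0 : 0 < N := by positivity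
  have hcard : ∀ (c : (Fin n → Bool) → Bool) (S : (Fin n → Bool) → Fin n → Bool),
      (#{x | c (mask M x) = true ∧ ∃ i ∈ D, S (mask M x) i = true} : ℝ) * N =
      2 ^ n * ∑ z, if mask M z = z ∧ c z = true ∧ ∃ i ∈ D, S z i = true then 1 else 0 := by
    intro c S
    have h := card_eq_sum_card_fiberwise (f := mask M)
      (s := {x | c (mask M x) = true ∧ ∃ i ∈ D, S (mask M x) i = true})
      (t := {z | mask M z = z}) fun x _ => by simp [mask_mask]
    rw [h]
    push_cast
    rw [sum_mul, mul_sum, sum_filter]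
    refine sum_congr rfl fun z _ => ?_
    by_cases hz : mask M z = z
    · rw [if_pos hz]
      by_cases hc : c z = true ∧ ∃ i ∈ D, S z i = true
      · rw [if_pos ⟨hz, hc⟩, mul_one, ← show ((#{x | mask M x = z} * 2 ^ #{j | M j = true} : ℕ) : ℝ) =
          2 ^ n by rw [card_fiber_mask hz]; norm_num]
        push_cast
        congr 3
        ext x
        simp only [mem_filter, mem_univ, true_and, and_iff_right_iff_imp]
        rintro rfl
        exact hc
      · rw [if_neg fun h => hc h.2, mul_zero, mul_eq_zero]
        left
        rw [Nat.cast_eq_zero, card_eq_zero, filter_eq_empty_iff]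
        intro x hx hxz
        rw [mem_filter, hxz] at hx
        exact hc hx.2
    · rw [if_neg hz, if_neg fun h => hz h.1, mul_zero]
  set κ : ℝ := Real.exp (-1) + (1 - Real.exp (-1)) * (1 - σ) ^ #D with hκ
  have he := Real.exp_neg_one_lt_d9
  have he0 := Real.exp_pos (-1)
  have hp0 : 0 ≤ (1 - σ) ^ #D := pow_nonneg (by linarith) _
  -- `κ` bounds the exponential moment of a parity-carrying address. The slack `7/12 - 1/3 = 1/4`
  -- becomes the rate in the conclusion.
  have hκ1 : κ ≤ 1 - 7 / 12 := by nlinarith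
  have hκ0 : 0 ≤ κ := by nlinarith
  have hinner : ∀ c : (Fin n → Bool) → Bool, ex (piW fun _ => bv σ)
      (fun S : (Fin n → Bool) → Fin n → Bool =>
        ind ((#{x | c (mask M x) = true ∧ ∃ i ∈ D, S (mask M x) i = true} : ℝ) < l / 3 * 2 ^ n)) ≤
      Real.exp (l * N / 3) * ∏ z, if mask M z = z then (if c z then κ else 1) else 1 := by
    intro c
    refine (hS.ex_ind_le_exp _ (fun S => l * N / 3 +
      ∑ z, if mask M z = z ∧ c z = true ∧ ∃ i ∈ D, S z i = true then -1 else 0) fun S hlt => ?_).trans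
      (le_of_eq ?_)
    · have h1 := hcard c S
      have h2 : (2 : ℝ) ^ n * (∑ z, if mask M z = z ∧ c z = true ∧ ∃ i ∈ D, S z i = true then 1 else 0)
          < 2 ^ n * (l * N / 3) := by
        rw [← h1]
        calc _ < l / 3 * 2 ^ n * N := mul_lt_mul_of_pos_right hlt hN0
          _ = _ := by ring
      have h3 := lt_of_mul_lt_mul_left h2 (by positivity)
      have h4 : ∑ z, (if mask M z = z ∧ c z = true ∧ ∃ i ∈ D, S z i = true then (-1 : ℝ) else 0) =
          -∑ z, if mask M z = z ∧ c z = true ∧ ∃ i ∈ D, S z i = true then 1 else 0 := by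
        rw [← sum_neg_distrib]
        exact sum_congr rfl fun z _ => by split_ifs <;> simp
      rw [h4]; linarith
    · simp only [Real.exp_add, Real.exp_sum]
      rw [ex_mul_left]
      congr 1
      rw [ex_piW_prod (fun _ : Fin n → Bool => bv (ι := Fin n) σ) fun z s =>
        Real.exp (if mask M z = z ∧ c z = true ∧ ∃ i ∈ D, s i = true then -1 else 0)]
      refine prod_congr rfl fun z _ => ?_
      by_cases hz : mask M z = z
      · by_cases hc : c z = true
        · simp only [hz, hc, true_and, if_true]
          rw [hκ, ← ex_exp_meet D hσ0 hσ1]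
          congr 1; funext s
          split_ifs <;> simp
        · simp [hc, (isProb_bv hσ0 hσ1).ex_const]
      · simp [hz, (isProb_bv hσ0 hσ1).ex_const]
  refine (hl.ex_mono hinner).trans ?_
  rw [ex_mul_left, ex_bv_prod l fun z b => if mask M z = z then (if b then κ else 1) else 1]
  have h5 : ∏ z, (l * (if mask M z = z then (if true = true then κ else 1) else 1) +
      (1 - l) * if mask M z = z then (if false = true then κ else 1) else 1) =
      (l * κ + (1 - l)) ^ (2 ^ #{j | M j = true}) := by
    rw [← card_addresses M, ← prod_const, prod_filter]
    exact prod_congr rfl fun z _ => by split_ifs <;> simp_all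
  rw [h5]
  have h6 : l * κ + (1 - l) ≤ Real.exp (-(l * (7 / 12))) := by
    have := Real.add_one_le_exp (-(l * (7 / 12)))
    nlinarith
  have h7 := pow_le_pow_left₀ (by nlinarith) h6 (2 ^ #{j | M j = true})
  rw [← Real.exp_nat_mul] at h7
  refine (mul_le_mul_of_nonneg_left h7 (Real.exp_pos _).le).trans_eq ?_
  rw [← Real.exp_add]
  congr 1
  push_cast
  rw [← hN]
  ring

/-! ### Distance from juntas -/

/-- Conditions that make `addrFun` far from all juntas. -/
theorem isFarFromJuntas_addrFun {n k : ℕ} {s ε l : ℝ} (hε : ε ≤ 1 / 6) (hl : l = 6 * ε)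
    {M A : Fin n → Bool} {c : (Fin n → Bool) → Bool} {S : (Fin n → Bool) → Fin n → Bool}
    {b : (Fin n → Bool) → Bool} (hU : k + s ≤ (#{i | (M i || A i) = true} : ℝ))
    (hM : ∀ i, M i = true →
      2 ^ n / 3 ≤ (#{x | addrFun M A c S b x ≠ addrFun M A c S b (flip i x)} : ℝ))
    (hD : ∀ D : Finset (Fin n), s ≤ #D →
      l / 3 * 2 ^ n ≤ (#{x | c (mask M x) = true ∧ ∃ i ∈ D, S (mask M x) i = true} : ℝ)) :
    IsFarFromJuntas k ε (addrFun M A c S b) := by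
  set f := addrFun M A c S b with hf
  rintro g ⟨J, hJ, g', hg'⟩
  have hg : ∀ i, i ∉ J → ∀ x, g (flip i x) = g x := by
    intro i hi x
    rw [hg', hg']
    congr 1; funext j
    refine flip_of_ne ?_ x
    rintro rfl
    exact hi j.2
  have h2n : (0 : ℝ) < 2 ^ n := by positivity
  by_cases hMJ : ∃ i, M i = true ∧ i ∉ J
  · obtain ⟨i, hi, hiJ⟩ := hMJ
    have h := card_le_two_mul_hammingDist f g {x | f x ≠ f (flip i x)} (flip i)
      (fun x hx => by
        simp only [mem_filter, mem_univ, true_and, flip_flip] at hx ⊢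
        exact hx.symm)
      (fun x _ => flip_flip i x)
      (fun x hx => by
        simp only [mem_filter, mem_univ, true_and] at hx
        exact hx.symm)
      (fun x _ => hg i hiJ x)
    have h' : (#{x | f x ≠ f (flip i x)} : ℝ) ≤ 2 * hammingDist f g := by exact_mod_cast h
    have := hM i hi
    nlinarith
  · push Not at hMJ
    -- Since `J` contains `M`, the omitted variables of `A` lie outside `M`, and flipping them
    -- preserves the address.
    let D : Finset (Fin n) := {i | A i = true ∧ i ∉ J}
    have hDM : ∀ i ∈ D, M i = false := by
      intro i hi
      simp only [mem_filter, mem_univ, true_and, D] at hi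
      by_contra hne
      exact hi.2 (hMJ i (by simpa using hne))
    have hDs : s ≤ #D := by
      have h1 : #{i | (M i || A i) = true} ≤ #(J ∪ D) := by
        refine card_le_card fun i hi => ?_
        simp only [mem_filter, mem_univ, true_and, Bool.or_eq_true, mem_union, D] at hi ⊢
        by_cases hiJ : i ∈ J
        · exact Or.inl hiJ
        · rcases hi with h | h
          · exact absurd (hMJ i h) hiJ
          · exact Or.inr ⟨h, hiJ⟩
      have h2 := card_union_le J D
      have h3 : (#{i | (M i || A i) = true} : ℝ) ≤ k + #D := by
        exact_mod_cast h1.trans (h2.trans (by omega))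
      linarith
    have hG := hD D hDs
    classical
    -- The flipped variable is chosen from the address alone, so `t` is an involution. It changes
    -- `f` on every subcube counted, but never `g`.
    let t : (Fin n → Bool) → Fin n → Bool := fun x =>
      if h : ∃ i ∈ D, S (mask M x) i = true then flip h.choose x else x
    have hP : ∀ x, (∃ i ∈ D, S (mask M x) i = true) → ∃ i ∈ D, S (mask M x) i = true ∧
        t x = flip i x ∧ t (flip i x) = x := by
      intro x h
      have hi := h.choose_spec.1
      have hMi : M h.choose = false := hDM _ hi
      refine ⟨h.choose, hi, h.choose_spec.2, dif_pos h, ?_⟩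
      have hm := mask_flip hMi x
      simp only [t, hm, h, dif_pos, flip_flip]
    have h := card_le_two_mul_hammingDist f g
      {x | c (mask M x) = true ∧ ∃ i ∈ D, S (mask M x) i = true} t ?_ ?_ ?_ ?_
    · have h' : (#{x | c (mask M x) = true ∧ ∃ i ∈ D, S (mask M x) i = true} : ℝ) ≤
          2 * hammingDist f g := by exact_mod_cast h
      rw [hl] at hG
      nlinarith
    all_goals
      intro x hx
      simp only [mem_filter, mem_univ, true_and] at hx
      obtain ⟨i, hiD, hSi, htx, htt⟩ := hP x hx.2
      have hiD' := hiD
      simp only [mem_filter, mem_univ, true_and, D] at hiD'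
      have hm := mask_flip (hDM i hiD) x
    · simp only [mem_filter, mem_univ, true_and, htx, hm]
      exact hx
    · rw [htx, htt]
    · rw [htx, hf]
      have hlin : ∑ j, (A j && S (mask M x) j) * flip i x j =
          (∑ j, (A j && S (mask M x) j) * x j) + true := by
        rw [← Finset.add_sum_erase _ _ (mem_univ i), ← Finset.add_sum_erase _ _ (mem_univ i),
          flip_self, hiD'.1, hSi]
        have : ∑ j ∈ univ.erase i, (A j && S (mask M x) j) * flip i x j =
            ∑ j ∈ univ.erase i, (A j && S (mask M x) j) * x j :=
          sum_congr rfl fun j hj => by rw [flip_of_ne (ne_of_mem_erase hj)]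
        rw [this]
        generalize ∑ j ∈ univ.erase i, (A j && S (mask M x) j) * x j = r
        cases r <;> cases x i <;> rfl
      simp only [addrFun, hm, hx.1, hlin]
      generalize ∑ j, (A j && S (mask M x) j) * x j = r
      generalize b (mask M x) = b'
      cases r <;> cases b' <;> decide
    · rw [htx]
      exact hg i hiD'.2 x

/-- With the larger density of `A`, the random function is very likely to be far from juntas. -/
theorem exFun_not_far_le {n k : ℕ} (hn : 1 ≤ n) {τ p l σ s ε t : ℝ} (hpar : Params τ p l σ)
    (hε0 : 0 < ε) (hε : ε ≤ 1 / 6) (hl : l = 6 * ε) (hs : ∀ d : ℕ, s ≤ d → (1 - σ) ^ d ≤ 1 / 20)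
    (hk : k + s + t * √n ≤ (1 - (1 - τ) * (1 - p)) * n)
    (hm : ∀ m : ℕ, τ * n - t * √n < m → (n : ℝ) ^ 2 ≤ ε * 2 ^ m) :
    exFun τ p l σ (fun M A c S b => ind (¬ IsFarFromJuntas (n := n) k ε (addrFun M A c S b))) ≤
      2 * Real.exp (1 - t) + 3 / n + 2 ^ n * Real.exp (-(3 / 2 * (n : ℝ) ^ 2)) := by
  have hn0 : (0 : ℝ) < n := by exact_mod_cast hn
  let I1 : (Fin n → Bool) → (Fin n → Bool) → ℝ := fun M A =>
    ind ((#{i | (M i || A i) = true} : ℝ) ≤ (1 - (1 - τ) * (1 - p)) * n - t * √n)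
  let I2 : (Fin n → Bool) → ℝ := fun M => ind ((#{i | M i = true} : ℝ) ≤ τ * n - t * √n)
  -- The size condition on `M` is built into the events `I3` and `I4`, so that their bounds hold for
  -- every fixed `M`; a small `M` is paid for once, by `I2`.
  let I3 : Fin n → (Fin n → Bool) → (Fin n → Bool) → ((Fin n → Bool) → Bool) →
      ((Fin n → Bool) → Fin n → Bool) → ((Fin n → Bool) → Bool) → ℝ := fun i M A c S b =>
    if M i = true ∧ (n : ℝ) ^ 2 ≤ ε * 2 ^ #{j | M j = true} then
      ind ((#{x | addrFun M A c S b x ≠ addrFun M A c S b (flip i x)} : ℝ) < 2 ^ n / 3) else 0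
  let I4 : Finset (Fin n) → (Fin n → Bool) → ((Fin n → Bool) → Bool) →
      ((Fin n → Bool) → Fin n → Bool) → ℝ := fun D M c S =>
    if s ≤ #D ∧ (n : ℝ) ^ 2 ≤ ε * 2 ^ #{j | M j = true} then
      ind ((#{x | c (mask M x) = true ∧ ∃ i ∈ D, S (mask M x) i = true} : ℝ) < l / 3 * 2 ^ n) else 0
  have h3n : ∀ i M A c S b, 0 ≤ I3 i M A c S b := fun i M A c S b => by
    simp only [I3]; split_ifs; exacts [ind_nonneg _, le_rfl]
  have h4n : ∀ D M c S, 0 ≤ I4 D M c S := fun D M c S => by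
    simp only [I4]; split_ifs; exacts [ind_nonneg _, le_rfl]
  have hpt : ∀ M A c S b, ind (¬ IsFarFromJuntas (n := n) k ε (addrFun M A c S b)) ≤
      ((I1 M A + I2 M) + ∑ i, I3 i M A c S b) + ∑ D, I4 D M c S := by
    intro M A c S b
    have a1 : 0 ≤ I1 M A := ind_nonneg _
    have a2 : 0 ≤ I2 M := ind_nonneg _
    have a3 := sum_nonneg fun i (_ : i ∈ univ) => h3n i M A c S b
    have a4 := sum_nonneg fun D (_ : D ∈ univ) => h4n D M c S
    refine ind_le_of (by positivity) fun hfar => ?_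
    by_contra hlt
    push Not at hlt
    apply hfar
    have b1 : ¬ ((#{i | (M i || A i) = true} : ℝ) ≤ (1 - (1 - τ) * (1 - p)) * n - t * √n) := by
      intro h
      have : I1 M A = 1 := ind_true h
      linarith
    have b2 : ¬ ((#{i | M i = true} : ℝ) ≤ τ * n - t * √n) := by
      intro h
      have : I2 M = 1 := ind_true h
      linarith
    have b2' := hm _ (not_le.1 b2)
    refine isFarFromJuntas_addrFun (s := s) hε hl (by linarith) (fun i hi => ?_) fun D hDs => ?_
    · by_contra h
      have h1 : I3 i M A c S b = 1 := by
        simp only [I3]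
        rw [if_pos ⟨hi, b2'⟩]
        exact ind_true (not_le.1 h)
      have := single_le_sum (fun i (_ : i ∈ univ) => h3n i M A c S b) (mem_univ i)
      linarith
    · by_contra h
      have h1 : I4 D M c S = 1 := by
        simp only [I4]
        rw [if_pos ⟨hDs, b2'⟩]
        exact ind_true (not_le.1 h)
      have := single_le_sum (fun D (_ : D ∈ univ) => h4n D M c S) (mem_univ D)
      linarith
  refine (hpar.mono hpt).trans ?_
  rw [exFun_add, exFun_add, exFun_add, exFun_sum, exFun_sum]
  have c1 : exFun τ p l σ (fun M A _ _ _ => I1 M A) ≤ Real.exp (1 - t) := by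
    rw [hpar.exFun_eq₂]
    exact ex_union_lower hn hpar.1.1 hpar.1.2 hpar.2.1.1 hpar.2.1.2
  have c2 : exFun τ p l σ (fun M _ _ _ _ => I2 M) ≤ Real.exp (1 - t) := by
    rw [hpar.exFun_eq₂ fun M _ => I2 M]
    simp only [(isProb_bv hpar.2.1.1 hpar.2.1.2).ex_const]
    exact ex_card_lower hn hpar.1.1 hpar.1.2
  have c3 : ∀ i, exFun τ p l σ (I3 i) ≤ 3 / (n : ℝ) ^ 2 := by
    intro i
    refine hpar.exFun_le_of₄ fun M A c S => ?_
    by_cases h : M i = true ∧ (n : ℝ) ^ 2 ≤ ε * 2 ^ #{j | M j = true}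
    · simp only [I3, h, and_self, if_true]
      refine (ex_ind_flip_le M A c S h.1).trans ?_
      rw [div_le_div_iff₀ (by positivity) (by positivity)]
      have : (0 : ℝ) < 2 ^ #{j | M j = true} := by positivity
      nlinarith [h.2]
    · simp only [I3, h, if_false, isProb_half.ex_const]
      positivity
  have c4 : ∀ D, exFun τ p l σ (fun M _ c S _ => I4 D M c S) ≤
      Real.exp (-(3 / 2 * (n : ℝ) ^ 2)) := by
    intro D
    refine hpar.exFun_le_of₂ fun M A => ?_
    simp only [isProb_half.ex_const]
    by_cases h : s ≤ #D ∧ (n : ℝ) ^ 2 ≤ ε * 2 ^ #{j | M j = true}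
    · simp only [I4, h, and_self, if_true]
      refine (ex_ind_parity_le M D hpar.2.2.1.1 hpar.2.2.1.2 hpar.2.2.2.1 hpar.2.2.2.2
        (hs _ h.1)).trans (Real.exp_le_exp.2 ?_)
      rw [hl]
      -- The exponent `6 * ε * 2 ^ |M| / 4` is at least `3 / 2 * n ^ 2`, which leaves room for the
      -- union bound over all `2 ^ n` sets `D`.
      nlinarith [h.2]
    · simp only [I4, h, if_false, hpar.isProb_S.ex_const,
        (isProb_bv hpar.2.2.1.1 hpar.2.2.1.2).ex_const]
      positivity
  have c3' := sum_le_sum fun i (_ : i ∈ univ) => c3 i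
  have c4' := sum_le_sum fun D (_ : D ∈ univ) => c4 D
  have e3 : ∑ _i : Fin n, 3 / (n : ℝ) ^ 2 = 3 / (n : ℝ) := by
    simp only [sum_const, card_univ, Fintype.card_fin, nsmul_eq_mul]
    field_simp
  have e4 : ∑ _D : Finset (Fin n), Real.exp (-(3 / 2 * (n : ℝ) ^ 2)) =
      2 ^ n * Real.exp (-(3 / 2 * (n : ℝ) ^ 2)) := by
    simp [sum_const, card_univ, Fintype.card_finset]
  rw [e3] at c3'
  rw [e4] at c4'
  linarith

/-! ### Randomized algorithms as mixtures of deterministic ones -/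

instance (n q : ℕ) : Finite (DetAlg n q) :=
  Finite.of_injective (fun D : DetAlg n q => (D.query, D.verdict)) fun D E h => by
    cases D; cases E; simpa using h

noncomputable instance (n q : ℕ) : Fintype (DetAlg n q) := Fintype.ofFinite _

theorem isProb_toReal {Ω : Type*} [Fintype Ω] (P : PMF Ω) : IsProb fun x => (P x).toReal := by
  refine ⟨fun x => ENNReal.toReal_nonneg, ?_⟩
  rw [← ENNReal.toReal_sum fun x _ => P.apply_ne_top x, ← tsum_fintype (L := .unconditional _),
    P.tsum_coe]
  rfl

/-- The probability that a randomized algorithm gives the verdict `v`. -/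
theorem toReal_output {n q : ℕ} (A : NonAdaptiveAlg n q) (f : BoolFun n) (v : Bool) :
    (NonAdaptiveAlg.output A f v).toReal =
      ex (fun D => (A D).toReal) fun D => if D.run f = v then 1 else 0 := by
  unfold NonAdaptiveAlg.output ex
  rw [PMF.map_apply, tsum_fintype, ENNReal.toReal_sum]
  · refine sum_congr rfl fun D _ => ?_
    by_cases h : D.run f = v
    · simp [h]
    · simp [h, Ne.symm h]
  · intro D _
    split_ifs
    · exact A.apply_ne_top D
    · simp

theorem le_toReal_output {n q : ℕ} {A : NonAdaptiveAlg n q} {f : BoolFun n} {v : Bool}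
    (h : 5 / 6 ≤ NonAdaptiveAlg.output A f v) :
    5 / 6 ≤ ex (fun D => (A D).toReal) fun D => if D.run f = v then 1 else 0 := by
  rw [← toReal_output]
  have := ENNReal.toReal_mono (PMF.apply_ne_top _ _) h
  simpa using this

/-- The trade-off between the number of queries and the advantage of a tester on the two random
functions. -/
theorem IsJuntaTester.advantage_le {n k r : ℕ} {A : NonAdaptiveAlg n r} {ε : ℝ}
    (hA : IsJuntaTester k ε A) {τ p q l σ η : ℝ} (hpar : Params τ p l σ) (hparq : Params τ q l σ)
    (hp : 1 / 4 ≤ p) (hp2 : p ≤ 1 / 2) (hq : p ≤ q) (hη : 0 < η) (L : ℕ) :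
    2 / 3 - exFun τ p l σ (fun M A c S b => ind (¬ IsJunta (n := n) k (addrFun M A c S b))) -
      exFun τ q l σ (fun M A c S b => ind (¬ IsFarFromJuntas (n := n) k ε (addrFun M A c S b))) ≤
    η / 2 + 8 * (q - p) ^ 2 * (σ * (l * (r * L + r ^ 2 * n * (1 - τ) ^ L))) / η := by
  have hw := isProb_toReal A
  let acc : BoolFun n → ℝ := fun f =>
    ex (fun D => (A D).toReal) fun D => if D.run f = true then 1 else 0
  have hacc0 : ∀ f, 0 ≤ acc f := fun f => hw.ex_nonneg fun D => by split_ifs <;> norm_num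
  have hacc1 : ∀ f, acc f ≤ 1 := fun f => hw.ex_le fun D => by split_ifs <;> norm_num
  have h1 : ∀ f, 5 / 6 - ind (¬ IsJunta k f) ≤ acc f := by
    intro f
    by_cases hf : IsJunta k f
    · rw [ind_false (not_not.2 hf), sub_zero]
      exact le_toReal_output (hA.1 f hf)
    · rw [ind_true hf]
      linarith [hacc0 f]
  have h2 : ∀ f, acc f ≤ 1 / 6 + ind (¬ IsFarFromJuntas k ε f) := by
    intro f
    by_cases hf : IsFarFromJuntas k ε f
    · rw [ind_false (not_not.2 hf)]
      have h := le_toReal_output (hA.2 f hf)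
      have h3 : acc f + ex (fun D => (A D).toReal) (fun D => if D.run f = false then 1 else 0) =
          1 := by
        rw [← ex_add]
        refine Eq.trans ?_ (hw.ex_const 1)
        congr 1; funext D
        cases D.run f <;> simp
      linarith
    · rw [ind_true hf]
      linarith [hacc1 f]
  have e1 := hpar.mono (n := n) fun M A c S b => h1 (addrFun M A c S b)
  rw [exFun_sub, hpar.exFun_const] at e1
  have e2 := hparq.mono (n := n) fun M A c S b => h2 (addrFun M A c S b)
  rw [exFun_add, hparq.exFun_const] at e2
  -- Averaging over the algorithm is exchanged with averaging over the function, so that it suffices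
  -- to treat fixed query strings.
  have hsw : ∀ r, exFun τ r l σ (fun M A c S b => acc (addrFun M A c S b)) =
      ex (fun D => (A D).toReal) fun D => exFun τ r l σ (fun M A c S b =>
        if D.run (addrFun M A c S b) = true then 1 else 0) := by
    intro r
    simp only [acc]
    unfold ex
    rw [exFun_sum]
    exact sum_congr rfl fun D _ => exFun_mul_left _
  have e3 : |exFun τ q l σ (fun M A c S b => acc (addrFun M A c S b)) -
      exFun τ p l σ (fun M A c S b => acc (addrFun M A c S b))| ≤
      η / 2 + 8 * (q - p) ^ 2 * (σ * (l * (r * L + r ^ 2 * n * (1 - τ) ^ L))) / η := by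
    rw [hsw, hsw, ← ex_sub]
    refine hw.abs_ex_le.trans (hw.ex_le fun D => ?_)
    exact abs_exFun_answers_sub_le D.query hpar.1.1 hpar.1.2 hpar.2.2.2.1 hpar.2.2.2.2
      hpar.2.2.1.1 hpar.2.2.1.2 hp hp2 hq hparq.2.1.2 hη
      (Φ := fun v => if D.verdict v = true then 1 else 0)
      (fun v => by split_ifs <;> norm_num) (fun v => by split_ifs <;> norm_num) L
  have e4 := (abs_le.1 e3).1
  linarith

/-- With the smaller density of `A`, the random function is very likely to be a junta. -/
theorem exFun_not_junta_le {n k : ℕ} (hn : 1 ≤ n) {τ p l σ t : ℝ} (hpar : Params τ p l σ)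
    (hk : (1 - (1 - τ) * (1 - p)) * n + t * √n ≤ k) :
    exFun τ p l σ (fun M A c S b => ind (¬ IsJunta (n := n) k (addrFun M A c S b))) ≤
      Real.exp (1 - t) := by
  refine (hpar.mono fun M A c S b => ind_mono (Q := (1 - (1 - τ) * (1 - p)) * n + t * √n ≤
    (#{i | (M i || A i) = true} : ℝ)) fun h => ?_).trans ?_
  · refine hk.trans ?_
    have : ¬ #{i | (M i || A i) = true} ≤ k := fun h' => h (isJunta_addrFun c S b h')
    exact_mod_cast (not_le.1 this).le
  · rw [hpar.exFun_eq₂ fun M A => ind ((1 - (1 - τ) * (1 - p)) * n + t * √n ≤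
      (#{i | (M i || A i) = true} : ℝ))]
    exact ex_union_upper hn hpar.1.1 hpar.1.2 hpar.2.1.1 hpar.2.1.2

/-! ### Numerical estimates and the choice of parameters -/

theorem exp_neg_four_le : Real.exp (1 - 5) ≤ 1 / 50 := by
  have h : Real.exp (1 - 5) = Real.exp (-1) ^ 4 := by
    rw [← Real.exp_nat_mul]; norm_num
  rw [h]
  have := Real.exp_neg_one_lt_d9
  calc Real.exp (-1) ^ 4 ≤ 0.3678794412 ^ 4 :=
        pow_le_pow_left₀ (Real.exp_pos _).le this.le 4
    _ ≤ 1 / 50 := by norm_num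

theorem one_sub_pow_le {σ : ℝ} (hσ0 : 0 < σ) (hσ1 : σ ≤ 1) {d : ℕ} (hd : 3 / σ ≤ d) :
    (1 - σ) ^ d ≤ 1 / 20 := by
  have h1 : 1 - σ ≤ Real.exp (-σ) := by
    have := Real.add_one_le_exp (-σ); linarith
  have h2 := pow_le_pow_left₀ (by linarith) h1 d
  rw [← Real.exp_nat_mul] at h2
  have h3 : Real.exp (d * -σ) ≤ Real.exp (-1) ^ 3 := by
    rw [← Real.exp_nat_mul, Real.exp_le_exp]
    rw [div_le_iff₀ hσ0] at hd
    push_cast; linarith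
  have := Real.exp_neg_one_lt_d9
  have h4 : Real.exp (-1) ^ 3 ≤ 0.3678794412 ^ 3 :=
    pow_le_pow_left₀ (Real.exp_pos _).le this.le 3
  have h5 : (0.3678794412 : ℝ) ^ 3 ≤ 1 / 20 := by norm_num
  linarith

/-- There are many more subcubes than `1 / ε`. -/
theorem sq_le_mul_two_pow {n m : ℕ} {τ ε : ℝ} (hn : 0 < n) (hs : 26 ≤ τ * √n)
    (hε : (2 : ℝ) ^ (-(τ * n / 2)) ≤ ε) (hm : τ * n - 5 * √n < m) : (n : ℝ) ^ 2 ≤ ε * 2 ^ m := by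
  have hn' : (0 : ℝ) < n := by exact_mod_cast hn
  have hs0 : 0 < √(n : ℝ) := Real.sqrt_pos.2 hn'
  have hsq : √(n : ℝ) * √n = n := Real.mul_self_sqrt hn'.le
  have h1 : (2 : ℝ) ^ (τ * n / 2 - 5 * √n) ≤ ε * 2 ^ m := by
    calc (2 : ℝ) ^ (τ * n / 2 - 5 * √n) ≤ 2 ^ (-(τ * n / 2) + m) :=
          Real.rpow_le_rpow_of_exponent_le (by norm_num) (by linarith)
      _ = 2 ^ (-(τ * n / 2)) * 2 ^ m := by
          rw [Real.rpow_add (by norm_num), Real.rpow_natCast]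
      _ ≤ ε * 2 ^ m := by gcongr
  refine le_trans ?_ h1
  rw [Real.rpow_def_of_pos (by norm_num)]
  have hlog : Real.log n ≤ 2 * √n := by
    have := Real.log_le_sub_one_of_pos hs0
    have h2 : Real.log n = 2 * Real.log √n := by
      rw [Real.log_sqrt hn'.le]; ring
    linarith
  have h2 : (n : ℝ) ^ 2 = Real.exp (2 * Real.log n) := by
    rw [two_mul, Real.exp_add, Real.exp_log hn']; ring
  rw [h2, Real.exp_le_exp]
  have hl2 := Real.log_two_gt_d9
  -- From `τ * √n ≥ 26`. It suffices because `n ^ 2 ≤ exp (4 * √n)` and `8 * log 2 > 4`.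
  have h3 : 8 * √(n : ℝ) ≤ τ * n / 2 - 5 * √n := by nlinarith
  nlinarith

theorem two_pow_mul_exp_le {n : ℕ} (hn : 4 ≤ n) :
    2 ^ n * Real.exp (-(3 / 2 * (n : ℝ) ^ 2)) ≤ 1 / 50 := by
  have h2 : (2 : ℝ) ^ n ≤ Real.exp n := by
    have : (2 : ℝ) ≤ Real.exp 1 := by
      have := Real.add_one_le_exp (1 : ℝ); linarith
    have h := pow_le_pow_left₀ (by norm_num) this n
    rwa [← Real.exp_nat_mul, mul_one] at h
  have hn' : (4 : ℝ) ≤ n := by exact_mod_cast hn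
  calc _ ≤ Real.exp n * Real.exp (-(3 / 2 * (n : ℝ) ^ 2)) := by gcongr
    _ = Real.exp (n + -(3 / 2 * (n : ℝ) ^ 2)) := (Real.exp_add _ _).symm
    _ ≤ Real.exp (1 - 5) := Real.exp_le_exp.2 (by nlinarith)
    _ ≤ _ := exp_neg_four_le

/-- The query lower bound before the choice of `L`. -/
theorem IsJuntaTester.query_bound {n k r : ℕ} {A : NonAdaptiveAlg n r} {ε α : ℝ}
    (hA : IsJuntaTester k ε A) (hα_low : 1 / 2 < α) (hα_high : α < 1) (hn : 100 ≤ n)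
    (hn1 : 26 ≤ (2 * α - 1) * √n) (hn2 : 36 ≤ 2 * (1 - α) * √n)
    (hk : |(k : ℝ) - α * n| < 1) (hε : (2 : ℝ) ^ (-((2 * α - 1) * n / 2)) ≤ ε) (hε6 : ε ≤ 1 / 6)
    (L : ℕ) :
    n * √n / ε ≤ 1536 * (9 / (2 * (1 - α))) ^ 2 * (r * L + r ^ 2 * n * (2 * (1 - α)) ^ L) := by
  have hε0 : 0 < ε := lt_of_lt_of_le (Real.rpow_pos_of_pos (by norm_num) _) hε
  have hn' : (100 : ℝ) ≤ n := by exact_mod_cast hn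
  have hs10 : 10 ≤ √(n : ℝ) := Real.le_sqrt_of_sq_le (by linarith)
  have hsq : √(n : ℝ) * √n = n := Real.mul_self_sqrt (by linarith)
  obtain ⟨hk1, hk2⟩ := abs_lt.1 hk
  obtain ⟨w, hw⟩ : ∃ w, w = 2 * (1 - α) := ⟨_, rfl⟩
  have hτw : 2 * α - 1 = 1 - w := by rw [hw]; ring
  have hα : α = 1 - w / 2 := by rw [hw]; ring
  have hw0 : 0 < w := by rw [hw]; linarith
  have hw1 : w < 1 := by rw [hw]; linarith
  rw [← hw] at hn2 ⊢
  rw [hτw] at hn1 hε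
  obtain ⟨s, hs⟩ : ∃ s, s = √(n : ℝ) := ⟨_, rfl⟩
  rw [← hs] at hs10 hsq hn2 ⊢
  have hs0 : 0 < s := by linarith
  -- The mean of `|M ∪ A|` moves by `w * δ * n = 9√n` from `αn`. On the far side this covers `3√n`
  -- omitted variables, a deviation of `5√n`, and `√n` for rounding `k`.
  obtain ⟨δ, hδ⟩ : ∃ δ, δ = 9 / (w * s) := ⟨_, rfl⟩
  have hδ0 : 0 < δ := by rw [hδ]; positivity
  have hδ4 : δ ≤ 1 / 4 := by
    rw [hδ, div_le_iff₀ (by positivity)]; linarith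
  have hwδ : w * δ * n = 9 * s := by
    rw [hδ, ← hsq]; field_simp
  have hσ0 : 0 < 1 / s := by positivity
  have hσ1 : 1 / s ≤ 1 := by rw [div_le_one hs0]; linarith
  have hpar : ∀ p : ℝ, 0 ≤ p → p ≤ 1 → Params (1 - w) p (6 * ε) (1 / s) := fun p h0 h1 =>
    ⟨⟨by linarith, by linarith⟩, ⟨h0, h1⟩, ⟨by linarith, by linarith⟩, ⟨hσ0.le, hσ1⟩⟩
  have hp := hpar (1 / 2 - δ) (by linarith) (by linarith)
  have hq := hpar (1 / 2 + δ) (by linarith) (by linarith)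
  have hadv := hA.advantage_le hp hq (by linarith) (by linarith) (by linarith)
    (η := 1 / 2) (by norm_num) L
  have hyes := exFun_not_junta_le (k := k) (t := 5) (by linarith : 1 ≤ n) hp (by
    rw [← hs]; rw [hα] at hk1; linear_combination hk1 - hwδ + (4 : ℝ) * hs10)
  have hno := exFun_not_far_le (k := k) (t := 5) (s := 3 * s) (by linarith : 1 ≤ n) hq hε0 hε6 rfl
    (fun d hd => one_sub_pow_le hσ0 hσ1 (by rwa [div_div_eq_mul_div, div_one]))
    (by rw [← hs]; rw [hα] at hk2; nlinarith)
    (fun m hm => sq_le_mul_two_pow (by linarith) hn1 hε hm)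
  have h4 := exp_neg_four_le
  have h2n := two_pow_mul_exp_le (n := n) (by linarith)
  have h3n : 3 / (n : ℝ) ≤ 3 / 100 := by gcongr
  obtain ⟨R, hR⟩ : ∃ R : ℝ, R = r * L + r ^ 2 * n * w ^ L := ⟨_, rfl⟩
  rw [sub_sub_cancel, ← hR] at hadv
  rw [← hR]
  -- The constant is `384 = 8 * 2 ^ 2 * 6 * 2`: the chi-square constant, the squared gap `(2δ)²`,
  -- the factor in `l = 6ε`, and `1 / η`.
  have e : 8 * (1 / 2 + δ - (1 / 2 - δ)) ^ 2 * (1 / s * (6 * ε * R)) / (1 / 2) =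
      384 * (9 / w) ^ 2 * R * (ε / (n * s)) := by
    rw [hδ, ← hsq]; field_simp; ring
  rw [e] at hadv
  -- The error probabilities total at most `1/50 + 9/100`, so the advantage exceeds `1/2`, while `η
  -- / 2` accounts for only `1/4`.
  have h5 : 1 / 4 ≤ 384 * (9 / w) ^ 2 * R * (ε / (n * s)) := by linarith
  have hns : 0 < n * s := by positivity
  rw [div_le_iff₀ hε0]
  rw [← mul_div_assoc, le_div_iff₀ hns] at h5
  linarith

end JuntaTesting

/-- In the bound of `query_bound`, a logarithmic `L` makes the term for distant collisions
negligible. Only a single logarithm is lost, so `C = 1`. -/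
theorem theorem2 (α : ℝ) (hα_low : 1 / 2 < α) (hα_high : α < 1) :
    ∃ (c : ℝ) (C : ℕ) (n₀ : ℕ), 0 < c ∧
      ∀ n : ℕ, n₀ ≤ n → ∀ (k : ℕ) (ε : ℝ),
        |(k : ℝ) - α * n| < 1 →
        (2 : ℝ) ^ (-((2 * α - 1) * n / 2)) ≤ ε → ε ≤ 1 / 6 →
        ∀ (q : ℕ) (A : JuntaTesting.NonAdaptiveAlg n q),
          JuntaTesting.IsJuntaTester k ε A →
          c * ((n : ℝ) ^ (3 / 2 : ℝ) / ε) / Real.log ((n : ℝ) ^ (3 / 2 : ℝ) / ε) ^ C ≤ (q : ℝ) := by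
  obtain ⟨w, hw⟩ : ∃ w, w = 2 * (1 - α) := ⟨_, rfl⟩
  have hw0 : 0 < w := by rw [hw]; linarith
  have hw1 : w < 1 := by rw [hw]; linarith
  have hlw : Real.log w < 0 := Real.log_neg hw0 hw1
  -- Chosen so that `w ^ (B * log Q) = Q ^ (-3)`, which beats `q ^ 2 * n ≤ Q ^ 3`.
  obtain ⟨B, hB⟩ : ∃ B, B = 3 / -Real.log w := ⟨_, rfl⟩
  have hB0 : 0 < B := by rw [hB]; exact div_pos (by norm_num) (by linarith)
  have hBw : B * Real.log w = -3 := by rw [hB]; have := hlw.ne; field_simp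
  obtain ⟨K, hK⟩ : ∃ K, K = 1536 * (9 / w) ^ 2 := ⟨_, rfl⟩
  have hK1 : 1 ≤ K := by
    have : 9 ≤ 9 / w := by rw [le_div_iff₀ hw0]; linarith
    rw [hK]; nlinarith
  have hK0 : 0 < K := by linarith
  have hτ0 : 0 < 2 * α - 1 := by linarith
  refine ⟨1 / (2 * K * (B + 1)), 1, ⌈(10 + 26 / (2 * α - 1) + 36 / w + 2 * K) ^ 2⌉₊, by positivity,
    fun n hn k ε hk hε hε6 q A hA => ?_⟩
  have hε0 : 0 < ε := lt_of_lt_of_le (Real.rpow_pos_of_pos (by norm_num) _) hε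
  have hs := Real.le_sqrt_of_sq_le ((Nat.le_ceil _).trans (Nat.cast_le.2 hn))
  have p1 : 0 < 26 / (2 * α - 1) := by positivity
  have p2 : 0 < 36 / w := by positivity
  have hs10 : 10 ≤ √(n : ℝ) := by linarith
  have hsq : √(n : ℝ) * √n = n := Real.mul_self_sqrt (Nat.cast_nonneg n)
  have hn100 : (100 : ℝ) ≤ n := by nlinarith
  have hn1 : 26 ≤ (2 * α - 1) * √n := by
    rw [← div_le_iff₀' hτ0]; linarith
  have hn2 : 36 ≤ w * √n := by
    rw [← div_le_iff₀' hw0]; linarith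
  have hpow : (n : ℝ) ^ (3 / 2 : ℝ) = n * √n := by
    rw [show (3 / 2 : ℝ) = 1 + 1 / 2 by norm_num, Real.rpow_add (by linarith), Real.rpow_one,
      ← Real.sqrt_eq_rpow]
  rw [hpow, pow_one]
  obtain ⟨Q, hQ⟩ : ∃ Q, Q = n * √n / ε := ⟨_, rfl⟩
  rw [← hQ]
  have hnQ : n * √n ≤ Q := by
    rw [hQ, le_div_iff₀ hε0]
    exact mul_le_of_le_one_right (by positivity) (by linarith)
  have hnQ' : (n : ℝ) ≤ Q :=
    (le_mul_of_one_le_right (Nat.cast_nonneg n) (by linarith)).trans hnQ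
  have hQ0 : 0 < Q := by linarith
  have hsn : √(n : ℝ) ≤ n :=
    (le_mul_of_one_le_right (Real.sqrt_nonneg n) (by linarith)).trans_eq hsq
  have hKQ : 2 * K ≤ Q := by linarith
  have hlogQ : 1 ≤ Real.log Q := by
    rw [Real.le_log_iff_exp_le hQ0]
    have := Real.exp_one_lt_d9
    linarith
  have hden : 0 < 2 * K * (B + 1) := by positivity
  rw [div_le_iff₀ (by linarith), one_div_mul_eq_div, div_le_iff₀ hden]
  -- More than `Q` queries already satisfy the claim, so `q ≤ Q` may be assumed when bounding the
  -- collision term.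
  by_cases hqQ : Q < q
  · have h1 : Q ≤ q * Real.log Q := by nlinarith
    have h2 : 1 ≤ 2 * K * (B + 1) := by nlinarith
    have h3 := mul_le_mul_of_nonneg_right h2 (hQ0.le.trans h1)
    linarith
  push Not at hqQ
  obtain ⟨L, hL⟩ : ∃ L : ℕ, L = ⌈B * Real.log Q⌉₊ := ⟨_, rfl⟩
  have hL1 : B * Real.log Q ≤ L := hL ▸ Nat.le_ceil _
  have hL2 : (L : ℝ) ≤ (B + 1) * Real.log Q := by
    have := Nat.ceil_lt_add_one (a := B * Real.log Q) (by positivity)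
    rw [← hL] at this
    linarith
  have hbound := hA.query_bound hα_low hα_high (by exact_mod_cast hn100) hn1 (hw ▸ hn2) hk hε hε6 L
  rw [← hQ, ← hw, ← hK] at hbound
  have hwL : w ^ L * Q ^ 3 ≤ 1 := by
    rw [← Real.exp_log (pow_pos hw0 L), ← Real.exp_log (pow_pos hQ0 3), ← Real.exp_add,
      Real.exp_le_one_iff, Real.log_pow, Real.log_pow]
    have := mul_le_mul_of_nonpos_right hL1 hlw.le
    push_cast
    linear_combination this + Real.log Q * hBw
  have hsmall : (q : ℝ) ^ 2 * n * w ^ L ≤ 1 := by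
    have hq0 : (0 : ℝ) ≤ q := Nat.cast_nonneg q
    calc (q : ℝ) ^ 2 * n * w ^ L ≤ Q ^ 2 * Q * w ^ L := by gcongr
      _ = w ^ L * Q ^ 3 := by ring
      _ ≤ 1 := hwL
  have h1 : (q : ℝ) * L ≤ q * ((B + 1) * Real.log Q) :=
    mul_le_mul_of_nonneg_left hL2 (Nat.cast_nonneg q)
  -- The negligible term contributes at most `K ≤ Q / 2`, which accounts for the factor `2` in the
  -- constant `c`.
  have h2 := mul_le_mul_of_nonneg_left (add_le_add h1 hsmall) hK0.le
  linarith
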